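/- Let $n\ge 2$, $[n-1]=\{1,\dots,n-1\}$ and $[\pm n]=\{\pm1,\dots,\pm n\}$. A $\mathrm D_n$-partition is a set partition $I$ of $[\pm n]$ such that $-K$ is a block of $I$ for every block $K$ of $I$, at most one block $K$ (a zero block) satisfies $-K=K$, and the zero block, if present, has more than two elements. Let $P_n^D$ be the set of $\mathrm D_n$-partitions. It is a commutative idempotent monoid, where the product of $I$ and $J$ is obtained from the join of $I$ and $J$ (their least common coarsening) by replacing all its zero blocks by their union, and where the unit is the partition into singletons. For $i,j\in[\pm n]$ with $i\neq\pm j$, let $\varepsilon_{i,j}\in P_n^D$ be the partition whose blocks are $\{i,j\}$, $\{-i,-j\}$ and singletons. Let $\mathcal B_n^D$ be the Artin braid group of type D: the group with generators $\sigma_i$, $i\in[n-1]\cup\{-1\}$, and relations (DB1)–(DB4) below. Let $\mathfrak S_n^D$ be the even-signed permutation group: the group of permutations $t$ of $[\pm n]$ with $t(-k)=-t(k)$ for all $k$ and $t(1)\cdots t(n)>0$. Let $\pi:\mathcal B_n^D\to\mathfrak S_n^D$ be the homomorphism $\sigma_k\mapsto t_k$, where, for $k\in[n-1]$, $t_k$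 exchanges $k$ with $k+1$ and $-k$ with $-(k+1)$, and $t_{-1}$ exchanges $-1$ with $2$ and $1$ with $-2$. Let $\mathcal B_n^D$ act on $P_n^D$ through $\pi$ and the permutation action of $\mathfrak S_n^D$ on blocks; write $\rho$ for this action. The tied monoid is the semidirect product $$T^D\mathcal B_n^D=P_n^D\rtimes_\rho\mathcal B_n^D,\qquad (b,a)(d,c)=(b\,\rho_a(d),\,ac)\quad(a,c\in\mathcal B_n^D,\ b,d\in P_n^D).$$ **Theorem.** As a monoid, $T^D\mathcal B_n^D$ is presented by the generators $\sigma_i$, $\sigma_i^{-1}$ and $\theta_i$, for $i\in[n-1]\cup\{-1\}$, subject to the relations below. Here $\sigma_i^{\pm1}$ stands for $(1,\sigma_i^{\pm1})$, $\theta_i$ for $(\varepsilon_{i,i+1},1)$ if $i\in[n-1]$, and $\theta_{-1}$ for $(\varepsilon_{-1,2},1)$; all indices $i,j$ run over $[n-1]\cup\{-1\}$ unless otherwise said, and a relation in which an index larger than $n-1$ would occur is absent (so (DB1) occurs only for $n\ge3$ and (TD6) only for $n\ge4$). - (DB0) $\sigma_i\sigma_i^{-1}=\sigma_i^{-1}\sigma_i=1$;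 - (DB1) $\sigma_{-1}\sigma_2\sigma_{-1}=\sigma_2\sigma_{-1}\sigma_2$; - (DB2) $\sigma_{-1}\sigma_i=\sigma_i\sigma_{-1}$ for $i\in[n-1]$, $i\ne2$; - (DB3) $\sigma_i\sigma_j\sigma_i=\sigma_j\sigma_i\sigma_j$ for $i,j\in[n-1]$, $|i-j|=1$; - (DB4) $\sigma_i\sigma_j=\sigma_j\sigma_i$ for $i,j\in[n-1]$, $|i-j|\ge2$; - (TD1) $\theta_i^2=\theta_i$; - (TD2) $\theta_i\theta_j=\theta_j\theta_i$; - (TD3) $\sigma_i\sigma_j\theta_i=\theta_j\sigma_i\sigma_j$ if $||i|-|j||=1$; - (TD4) $\sigma_i\theta_j=\theta_j\sigma_i$ if $||i|-|j||\neq1$; - (TD5) $\theta_i\theta_j\sigma_i=\theta_j\sigma_i\theta_j=\sigma_i\theta_i\theta_j$ if $||i|-|j||=1$; - (TD6) $\theta_{-1}\theta_1\theta_3\sigma_2\sigma_{-1}\sigma_1\sigma_2\theta_3=\theta_{-1}\theta_1\theta_2\theta_3\sigma_2\sigma_{-1}\sigma_1\sigma_2$; - (TD7) $\sigma_i\sigma_j^{-1}\theta_i=\theta_j\sigma_i\sigma_j^{-1}$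 if $||i|-|j||=1$. That is, sending each generator to the element it stands for induces an isomorphism from the free monoid on these generators modulo the congruence generated by the relations onto $T^D\mathcal B_n^D$. -/

import Mathlib

namespace TiedD

/-! ### The set `[±n]` and the partitions of type D -/

/-- `[±n] = {±1, …, ±n}`. -/
abbrev PMSet (n : ℕ) : Type := {k : ℤ // k ≠ 0 ∧ |k| ≤ (n : ℤ)}

instance (n : ℕ) : InvolutiveNeg (PMSet n) where
  neg k := ⟨-k.1, neg_ne_zero.mpr k.2.1, by rw [abs_neg]; exact k.2.2⟩
  neg_neg k := Subtype.ext (neg_neg k.1)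

@[simp] theorem coe_neg {n : ℕ} (k : PMSet n) : ((-k : PMSet n) : ℤ) = -(k : ℤ) := rfl

theorem neg_ne_self {n : ℕ} (k : PMSet n) : -k ≠ k := by
  intro h
  have h1 := congrArg Subtype.val h
  have h2 := k.2.1
  simp only [coe_neg] at h1
  omega

instance (n : ℕ) : Finite (PMSet n) :=
  Set.Finite.to_subtype ((Set.finite_Icc (-(n : ℤ)) n).subset fun _ hk => abs_le.mp hk.2)

/-- Set partitions of `[±n]` are encoded, as usual, by equivalence relations; the blocks are the
equivalence classes. A partition is signed if `-K` is a block for every block `K`. -/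
def IsSigned {n : ℕ} (r : Setoid (PMSet n)) : Prop := ∀ x y, r x y → r (-x) (-y)

/-- A `D_n`-partition: a signed partition of `[±n]` with at most one zero block (a block `K` with
`-K = K`), the zero block, if present, having more than two elements. In a signed partition the
block of `x` is a zero block if and only if it contains `-x`. -/
structure IsDPartition {n : ℕ} (r : Setoid (PMSet n)) : Prop where
  signed : IsSigned r
  unique_zero : ∀ x y, r x (-x) → r y (-y) → r x y
  positive : ∀ x, r x (-x) → 2 < {y | r x y}.ncard

/-- The set `P_n^D` of `D_n`-partitions. -/
def PD (n : ℕ) : Type := {r : Setoid (PMSet n) // IsDPartition r}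

theorem PD.ext {n : ℕ} {I J : PD n} (h : I.1 = J.1) : I = J := Subtype.ext h

/-- The zero closure: all the zero blocks are replaced by their union. -/
def zeroClosure {n : ℕ} (r : Setoid (PMSet n)) (hr : IsSigned r) : Setoid (PMSet n) where
  r x y := r x y ∨ (r x (-x) ∧ r y (-y))
  iseqv := by
    have key : ∀ x y, r x y → r x (-x) → r y (-y) := fun x y h hx =>
      r.trans (r.symm h) (r.trans hx (hr x y h))
    refine ⟨fun x => Or.inl (r.refl x), ?_, ?_⟩
    · rintro x y (h | ⟨h, k⟩)
      · exact Or.inl (r.symm h)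
      · exact Or.inr ⟨k, h⟩
    · rintro x y z (h | ⟨h, k⟩) (h' | ⟨h', k'⟩)
      · exact Or.inl (r.trans h h')
      · exact Or.inr ⟨key y x (r.symm h) h', k'⟩
      · exact Or.inr ⟨h, key y z h' k⟩
      · exact Or.inr ⟨h, k'⟩

theorem le_zeroClosure {n : ℕ} (r : Setoid (PMSet n)) (hr : IsSigned r) :
    r ≤ zeroClosure r hr := fun _ _ h => Or.inl h

theorem zeroClosure_le {n : ℕ} {r s : Setoid (PMSet n)} (hr : IsSigned r) (h : r ≤ s)
    (hs : ∀ x y, s x (-x) → s y (-y) → s x y) : zeroClosure r hr ≤ s := by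
  rintro x y (h' | ⟨h1, h2⟩)
  · exact h h'
  · exact hs x y (h h1) (h h2)

theorem IsSigned.sup {n : ℕ} {r s : Setoid (PMSet n)} (hr : IsSigned r) (hs : IsSigned s) :
    IsSigned (r ⊔ s) := by
  have h : r ⊔ s ≤ Setoid.comap (fun x => -x) (r ⊔ s) := by
    refine sup_le ?_ ?_
    · intro x y h
      exact (le_sup_left : r ≤ r ⊔ s) (hr x y h)
    · intro x y h
      exact (le_sup_right : s ≤ r ⊔ s) (hs x y h)
  exact fun x y hxy => h hxy

theorem isDPartition_zeroClosure_sup {n : ℕ} {r s : Setoid (PMSet n)} (hr : IsDPartition r)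
    (hs : IsDPartition s) :
    IsDPartition (zeroClosure (r ⊔ s) (hr.signed.sup hs.signed)) := by
  have hsg := hr.signed.sup hs.signed
  have hz : ∀ x, zeroClosure (r ⊔ s) hsg x (-x) → (r ⊔ s) x (-x) := by
    rintro x (h | ⟨h, -⟩) <;> exact h
  refine ⟨?_, fun x y hx hy => Or.inr ⟨hz x hx, hz y hy⟩, ?_⟩
  · rintro x y (h | ⟨h, k⟩)
    · exact Or.inl (hsg x y h)
    · exact Or.inr ⟨hsg _ _ h, hsg _ _ k⟩
  · intro x hx
    replace hx := hz x hx
    have mono : ∀ t : Setoid (PMSet n), t ≤ r ⊔ s → 2 < {y | t x y}.ncard →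
        2 < {y | zeroClosure (r ⊔ s) hsg x y}.ncard := fun t ht h =>
      h.trans_le (Set.ncard_le_ncard (fun y hy => Or.inl (ht hy)) (Set.toFinite _))
    by_cases h1 : r x (-x)
    · exact mono r le_sup_left (hr.positive x h1)
    by_cases h2 : s x (-x)
    · exact mono s le_sup_right (hs.positive x h2)
    have hex : ∃ y, (r ⊔ s) x y ∧ y ≠ x ∧ y ≠ -x := by
      by_contra hcon
      push Not at hcon
      have sep : ∀ t : Setoid (PMSet n), t ≤ r ⊔ s → ¬ t x (-x) →
          t ≤ (r ⊔ s) ⊓ Setoid.ker (fun z => z = x) := by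
        intro t ht hx' y z hyz
        refine ⟨ht hyz, ?_⟩
        have aux : ∀ a b, t a b → a = x → b = x := by
          rintro a b hab rfl
          by_contra hb
          have := hcon b (ht hab) hb
          subst this
          exact hx' hab
        exact propext ⟨aux y z hyz, aux z y (t.symm hyz)⟩
      have h3 : r ⊔ s ≤ (r ⊔ s) ⊓ Setoid.ker (fun z => z = x) :=
        sup_le (sep r le_sup_left h1) (sep s le_sup_right h2)
      have h4 : (x = x) = (-x = x) := (h3 hx).2
      exact neg_ne_self x (h4 ▸ rfl)
    obtain ⟨y, hy, hyx, hynx⟩ := hex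
    have h5 : ({x, -x, y} : Set (PMSet n)).ncard = 3 := by
      rw [Set.ncard_eq_toFinset_card', Set.toFinset_insert, Set.toFinset_insert,
        Set.toFinset_singleton, Finset.card_eq_three.mpr]
      exact ⟨x, -x, y, (neg_ne_self x).symm, hyx.symm, hynx.symm, rfl⟩
    have h6 : ({x, -x, y} : Set (PMSet n)) ⊆ {y | zeroClosure (r ⊔ s) hsg x y} := by
      rintro z (rfl | rfl | rfl)
      · exact Or.inl ((r ⊔ s).refl z)
      · exact Or.inl hx
      · exact Or.inl hy
    have h7 := Set.ncard_le_ncard h6 (Set.toFinite _)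
    omega

/-- The product of two `D_n`-partitions is the zero closure of their join. -/
instance (n : ℕ) : Mul (PD n) where
  mul I J := ⟨zeroClosure (I.1 ⊔ J.1) (I.2.signed.sup J.2.signed),
    isDPartition_zeroClosure_sup I.2 J.2⟩

/-- The unit is the partition into singletons. -/
instance (n : ℕ) : One (PD n) where
  one := ⟨⊥, fun x y (h : x = y) => congrArg Neg.neg h,
    fun x _ (h : x = -x) => absurd h.symm (neg_ne_self x),
    fun x (h : x = -x) => absurd h.symm (neg_ne_self x)⟩

theorem PD.coe_one (n : ℕ) : (1 : PD n).1 = ⊥ := rfl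

theorem PD.coe_mul {n : ℕ} (I J : PD n) :
    (I * J).1 = zeroClosure (I.1 ⊔ J.1) (I.2.signed.sup J.2.signed) := rfl

theorem PD.mul_le_iff {n : ℕ} {I J K : PD n} : (I * J).1 ≤ K.1 ↔ I.1 ≤ K.1 ∧ J.1 ≤ K.1 := by
  constructor
  · intro h
    have h' := (le_zeroClosure _ (I.2.signed.sup J.2.signed)).trans h
    exact sup_le_iff.mp h'
  · intro h
    exact zeroClosure_le (I.2.signed.sup J.2.signed) (sup_le h.1 h.2) K.2.unique_zero

theorem PD.eq_of_forall_le {n : ℕ} {I J : PD n} (h : ∀ K : PD n, I.1 ≤ K.1 ↔ J.1 ≤ K.1) :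
    I = J :=
  PD.ext (le_antisymm ((h J).mpr le_rfl) ((h I).mp le_rfl))

instance (n : ℕ) : CommMonoid (PD n) where
  mul_assoc I J K := PD.eq_of_forall_le fun L => by simp only [PD.mul_le_iff, and_assoc]
  mul_comm I J := PD.eq_of_forall_le fun L => by simp only [PD.mul_le_iff, and_comm]
  one_mul I := PD.eq_of_forall_le fun L => by simp [PD.mul_le_iff, PD.coe_one]
  mul_one I := PD.eq_of_forall_le fun L => by simp [PD.mul_le_iff, PD.coe_one]

/-- The partition `ε_{i,j}`, whose blocks are `{i, j}`, `{-i, -j}` and singletons. -/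
def eps {n : ℕ} (i j : PMSet n) (hij : i ≠ -j) : PD n :=
  ⟨{ r := fun x y => x = y ∨ ((x = i ∨ x = j) ∧ (y = i ∨ y = j)) ∨
        ((x = -i ∨ x = -j) ∧ (y = -i ∨ y = -j))
     iseqv := by
      have hj : j ≠ -i := fun h => hij (by rw [h, neg_neg])
      have h1 := neg_ne_self i
      have h2 := neg_ne_self j
      refine ⟨fun x => Or.inl rfl, ?_, ?_⟩
      · intro x y h
        rcases h with h | h | h
        · exact Or.inl h.symm
        · exact Or.inr (Or.inl ⟨h.2, h.1⟩)
        · exact Or.inr (Or.inr ⟨h.2, h.1⟩)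
      · intro x y z h h'
        rcases h with rfl | h | h
        · exact h'
        · rcases h' with rfl | h' | h'
          · exact Or.inr (Or.inl h)
          · exact Or.inr (Or.inl ⟨h.1, h'.2⟩)
          · grind
        · rcases h' with rfl | h' | h'
          · exact Or.inr (Or.inr h)
          · grind
          · exact Or.inr (Or.inr ⟨h.1, h'.2⟩) }, by
    have hj : j ≠ -i := fun h => hij (by rw [h, neg_neg])
    have h1 := neg_ne_self i
    have h2 := neg_ne_self j
    have key : ∀ x : PMSet n, ¬ (x = -x ∨ ((x = i ∨ x = j) ∧ (-x = i ∨ -x = j)) ∨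
        ((x = -i ∨ x = -j) ∧ (-x = -i ∨ -x = -j))) := by
      intro x
      have h3 := neg_ne_self x
      have e1 : -x = -i ↔ x = i := neg_inj
      have e2 : -x = -j ↔ x = j := neg_inj
      have e3 : -x = i ↔ x = -i := neg_eq_iff_eq_neg
      have e4 : -x = j ↔ x = -j := neg_eq_iff_eq_neg
      grind
    refine ⟨?_, fun x _ h => absurd h (key x), fun x h => absurd h (key x)⟩
    rintro x y (rfl | ⟨h, h'⟩ | ⟨h, h'⟩)
    · exact Or.inl rfl
    · exact Or.inr (Or.inr ⟨h.imp (congrArg _) (congrArg _), h'.imp (congrArg _) (congrArg _)⟩)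
    · refine Or.inr (Or.inl ⟨h.imp ?_ ?_, h'.imp ?_ ?_⟩) <;> rintro rfl <;> exact neg_neg _⟩

/-! ### The even-signed permutation group and its action on `P_n^D` -/

/-- The signed symmetric group: permutations `t` of `[±n]` with `t(-k) = -t(k)`. -/
def signedPerm (n : ℕ) : Subgroup (Equiv.Perm (PMSet n)) where
  carrier := {t | ∀ k, t (-k) = -t k}
  one_mem' := fun _ => rfl
  mul_mem' := by
    intro s t hs ht k
    simp only [Equiv.Perm.mul_apply]
    rw [ht, hs]
  inv_mem' := by
    intro t ht k
    rw [Equiv.Perm.inv_eq_iff_eq, ht]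
    simp

theorem mem_signedPerm {n : ℕ} {t : Equiv.Perm (PMSet n)} :
    t ∈ signedPerm n ↔ ∀ k, t (-k) = -t k := Iff.rfl

/-- The element `i + 1` of `[±n]`, for `i = 0, …, n - 1`. -/
def pos {n : ℕ} (i : Fin n) : PMSet n :=
  ⟨(i : ℤ) + 1, by omega, by rw [abs_of_nonneg (by omega)]; have := i.2; omega⟩

/-- The index of `|k|`. -/
def absIdx {n : ℕ} (k : PMSet n) : Fin n :=
  ⟨k.1.natAbs - 1, by
    have h1 := k.2.1
    have h2 := k.2.2
    rw [Int.abs_eq_natAbs] at h2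
    omega⟩

theorem absIdx_pos {n : ℕ} (i : Fin n) : absIdx (pos i) = i := by
  apply Fin.ext
  simp only [absIdx, pos]
  omega

theorem absIdx_neg {n : ℕ} (k : PMSet n) : absIdx (-k) = absIdx k := by
  apply Fin.ext
  simp [absIdx]

theorem eq_pos_or {n : ℕ} (k : PMSet n) :
    (0 < k.1 ∧ k = pos (absIdx k)) ∨ (k.1 < 0 ∧ k = -pos (absIdx k)) := by
  have h1 := k.2.1
  rcases lt_or_gt_of_ne h1 with h | h
  · refine Or.inr ⟨h, Subtype.ext ?_⟩
    simp only [absIdx, pos, coe_neg]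
    omega
  · refine Or.inl ⟨h, Subtype.ext ?_⟩
    simp only [absIdx, pos]
    omega

theorem sign_signed {n : ℕ} {s : Equiv.Perm (PMSet n)} (hs : s ∈ signedPerm n) (k : PMSet n) :
    SignType.sign (s k).1 = SignType.sign k.1 * SignType.sign (s (pos (absIdx k))).1 := by
  rcases eq_pos_or k with ⟨h, hk⟩ | ⟨h, hk⟩
  · rw [sign_pos h, one_mul, ← hk]
  · rw [sign_neg h]
    conv_lhs => rw [hk, hs, coe_neg, Left.sign_neg]
    simp

theorem absIdx_perm_bijective {n : ℕ} {t : Equiv.Perm (PMSet n)} (ht : t ∈ signedPerm n) :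
    Function.Bijective fun i : Fin n => absIdx (t (pos i)) := by
  refine (Finite.injective_iff_bijective).mp fun i j hij => ?_
  replace hij : absIdx (t (pos i)) = absIdx (t (pos j)) := hij
  have key : t (pos i) = t (pos j) ∨ t (pos i) = t (-pos j) := by
    rw [ht]
    rcases eq_pos_or (t (pos i)) with ⟨-, h⟩ | ⟨-, h⟩ <;>
      rcases eq_pos_or (t (pos j)) with ⟨-, h'⟩ | ⟨-, h'⟩ <;> rw [h, h', hij] <;> simp
  rcases key with h | h
  · have := congrArg absIdx (t.injective h)
    rwa [absIdx_pos, absIdx_pos] at this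
  · have := congrArg absIdx (t.injective h)
    rwa [absIdx_neg, absIdx_pos, absIdx_pos] at this

/-- The sign of `t(1) ⋯ t(n)`. -/
noncomputable def signProd {n : ℕ} (t : Equiv.Perm (PMSet n)) : SignType :=
  SignType.sign (∏ i : Fin n, (t (pos i) : ℤ))

theorem signProd_eq {n : ℕ} (t : Equiv.Perm (PMSet n)) :
    signProd t = ∏ i : Fin n, SignType.sign (t (pos i) : ℤ) :=
  map_prod (signHom : ℤ →*₀ SignType) _ _

theorem signProd_mul {n : ℕ} {s t : Equiv.Perm (PMSet n)} (hs : s ∈ signedPerm n)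
    (ht : t ∈ signedPerm n) : signProd (s * t) = signProd s * signProd t := by
  rw [signProd_eq, signProd_eq, signProd_eq]
  have h : ∀ i : Fin n, SignType.sign ((s * t) (pos i) : ℤ) =
      SignType.sign (s (pos (absIdx (t (pos i)))) : ℤ) * SignType.sign (t (pos i) : ℤ) := by
    intro i
    rw [Equiv.Perm.mul_apply, sign_signed hs, mul_comm]
  rw [Finset.prod_congr rfl fun i _ => h i, Finset.prod_mul_distrib]
  congr 1
  exact (absIdx_perm_bijective ht).prod_comp fun j => SignType.sign (s (pos j) : ℤ)

theorem signProd_one {n : ℕ} : signProd (1 : Equiv.Perm (PMSet n)) = 1 := by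
  rw [signProd_eq]
  refine Finset.prod_eq_one fun i _ => sign_pos ?_
  simp only [Equiv.Perm.one_apply, pos]
  omega

/-- The even-signed permutation group: signed permutations `t` with `t(1) ⋯ t(n) > 0`. -/
def evenSignedPerm (n : ℕ) : Subgroup (Equiv.Perm (PMSet n)) where
  carrier := {t | t ∈ signedPerm n ∧ 0 < ∏ i : Fin n, (t (pos i) : ℤ)}
  one_mem' := ⟨one_mem _, sign_eq_one_iff.mp signProd_one⟩
  mul_mem' := by
    rintro s t ⟨hs, hs'⟩ ⟨ht, ht'⟩
    refine ⟨mul_mem hs ht, sign_eq_one_iff.mp ?_⟩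
    change signProd (s * t) = 1
    rw [signProd_mul hs ht, signProd, signProd, sign_pos hs', sign_pos ht', one_mul]
  inv_mem' := by
    rintro t ⟨ht, ht'⟩
    refine ⟨inv_mem ht, sign_eq_one_iff.mp ?_⟩
    have h := signProd_mul ht (inv_mem ht)
    rw [mul_inv_cancel, signProd_one] at h
    rw [show signProd t = 1 from sign_pos ht', one_mul] at h
    exact h.symm

theorem mem_evenSignedPerm {n : ℕ} {t : Equiv.Perm (PMSet n)} :
    t ∈ evenSignedPerm n ↔ t ∈ signedPerm n ∧ 0 < ∏ i : Fin n, (t (pos i) : ℤ) := Iff.rfl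

theorem mem_evenSignedPerm_iff {n : ℕ} {t : Equiv.Perm (PMSet n)} :
    t ∈ evenSignedPerm n ↔ t ∈ signedPerm n ∧ signProd t = 1 := by
  rw [mem_evenSignedPerm, signProd, sign_eq_one_iff]

/-- The image `t(I)` of a `D_n`-partition: its blocks are the sets `t(K)`, `K` a block of `I`. -/
def permPD {n : ℕ} (t : Equiv.Perm (PMSet n)) (ht : t ∈ signedPerm n) (I : PD n) : PD n :=
  ⟨Setoid.comap (t⁻¹ : Equiv.Perm (PMSet n)) I.1, by
    have hi := inv_mem ht
    rw [mem_signedPerm] at hi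
    refine ⟨?_, ?_, ?_⟩
    · intro x y h
      rw [Setoid.comap_rel] at h ⊢
      rw [hi, hi]
      exact I.2.signed _ _ h
    · intro x y hx hy
      rw [Setoid.comap_rel] at hx hy ⊢
      rw [hi] at hx hy
      exact I.2.unique_zero _ _ hx hy
    · intro x hx
      rw [Setoid.comap_rel, hi] at hx
      have h := I.2.positive _ hx
      have e : {y | (Setoid.comap (t⁻¹ : Equiv.Perm (PMSet n)) I.1) x y} =
          t '' {y | I.1 ((t⁻¹ : Equiv.Perm (PMSet n)) x) y} := by
        ext y
        rw [Equiv.image_eq_preimage_symm]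
        rfl
      rw [e, Set.ncard_image_of_injective _ t.injective]
      exact h⟩

theorem permPD_le_iff {n : ℕ} {t : Equiv.Perm (PMSet n)} (ht : t ∈ signedPerm n) {I J : PD n} :
    (permPD t ht I).1 ≤ J.1 ↔ I.1 ≤ (permPD t⁻¹ (inv_mem ht) J).1 := by
  constructor
  · intro h x y hxy
    change J.1 (t⁻¹⁻¹ x) (t⁻¹⁻¹ y)
    rw [inv_inv]
    apply h
    change I.1 (t⁻¹ (t x)) (t⁻¹ (t y))
    simpa using hxy
  · intro h x y hxy
    have h1 : J.1 (t⁻¹⁻¹ (t⁻¹ x)) (t⁻¹⁻¹ (t⁻¹ y)) := h hxy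
    simpa using h1

/-- The permutation action of the even-signed permutation group on `P_n^D`. -/
def permAction (n : ℕ) : evenSignedPerm n →* Monoid.End (PD n) where
  toFun t :=
    { toFun := permPD t.1 t.2.1
      map_one' := PD.ext (by
        ext x y
        exact t.1⁻¹.injective.eq_iff)
      map_mul' := fun I J => PD.eq_of_forall_le fun K => by
        simp only [permPD_le_iff, PD.mul_le_iff] }
  map_one' := rfl
  map_mul' _ _ := rfl

/-! ### The generators of the even-signed permutation group -/

/-- The signed transposition exchanging `a` with `b` and `-a` with `-b`. -/
def signedTransp {n : ℕ} (a b : PMSet n) : Equiv.Perm (PMSet n) :=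
  Equiv.swap a b * Equiv.swap (-a) (-b)

theorem signedTransp_comm {n : ℕ} (a b : PMSet n) : signedTransp a b = signedTransp b a := by
  simp only [signedTransp, Equiv.swap_comm]

theorem signedTransp_apply {n : ℕ} {a b : PMSet n} (hab : a ≠ -b) (x : PMSet n) :
    signedTransp a b x = if x = a then b else if x = b then a else
      if x = -a then -b else if x = -b then -a else x := by
  have h1 := neg_ne_self a
  have h2 := neg_ne_self b
  have hba : b ≠ -a := fun h => hab (by rw [h, neg_neg])
  have e : -a = -b ↔ a = b := neg_inj
  simp only [signedTransp, Equiv.Perm.mul_apply, Equiv.swap_apply_def]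
  grind

theorem signedTransp_mem {n : ℕ} {a b : PMSet n} (hab : a ≠ -b) :
    signedTransp a b ∈ signedPerm n := by
  intro x
  have h1 := neg_ne_self a
  have h2 := neg_ne_self b
  have hba : b ≠ -a := fun h => hab (by rw [h, neg_neg])
  have e : a = b ↔ -a = -b := neg_inj.symm
  have e1 : -x = -a ↔ x = a := neg_inj
  have e2 : -x = -b ↔ x = b := neg_inj
  have e3 : -x = a ↔ x = -a := neg_eq_iff_eq_neg
  have e4 : -x = b ↔ x = -b := neg_eq_iff_eq_neg
  have e5 := neg_neg a
  have e6 := neg_neg b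
  rw [signedTransp_apply hab, signedTransp_apply hab]
  grind

theorem signedTransp_neg {n : ℕ} {a b : PMSet n} (hab : a ≠ -b) :
    signedTransp (-a) (-b) = signedTransp a b := by
  have h1 := neg_ne_self a
  have h2 := neg_ne_self b
  have hba : b ≠ -a := fun h => hab (by rw [h, neg_neg])
  have e : a = b ↔ -a = -b := neg_inj.symm
  ext1 x
  rw [signedTransp_apply hab, signedTransp_apply (a := -a) (b := -b) (by simpa using hba.symm)]
  simp only [neg_neg]
  grind

theorem signedTransp_mul_self {n : ℕ} {a b : PMSet n} (hab : a ≠ -b) :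
    signedTransp a b * signedTransp a b = 1 := by
  have h1 := neg_ne_self a
  have h2 := neg_ne_self b
  have hba : b ≠ -a := fun h => hab (by rw [h, neg_neg])
  have e : a = b ↔ -a = -b := neg_inj.symm
  ext1 x
  rw [Equiv.Perm.mul_apply, signedTransp_apply hab, signedTransp_apply hab,
    Equiv.Perm.one_apply]
  grind

theorem mul_signedTransp {n : ℕ} {g : Equiv.Perm (PMSet n)} (hg : g ∈ signedPerm n)
    (a b : PMSet n) : g * signedTransp a b = signedTransp (g a) (g b) * g := by
  rw [mem_signedPerm] at hg
  have h1 := Equiv.mul_swap_eq_swap_mul g a b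
  have h2 := Equiv.mul_swap_eq_swap_mul g (-a) (-b)
  rw [hg, hg] at h2
  rw [signedTransp, signedTransp, ← mul_assoc, h1, mul_assoc, h2, mul_assoc]

theorem signProd_swap {n : ℕ} {a b : PMSet n} (ha : 0 < a.1) (hb : 0 < b.1) :
    signProd (signedTransp a b) = 1 := by
  have hab : a ≠ -b := by
    intro h
    have := congrArg Subtype.val h
    simp only [coe_neg] at this
    omega
  rw [signProd_eq]
  refine Finset.prod_eq_one fun i _ => sign_pos ?_
  have hi : 0 < (pos i).1 := by simp only [pos]; omega
  rw [signedTransp_apply hab]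
  split_ifs with c1 c2 c3 c4
  · exact hb
  · exact ha
  · have := congrArg Subtype.val c3
    simp only [coe_neg] at this
    omega
  · have := congrArg Subtype.val c4
    simp only [coe_neg] at this
    omega
  · exact hi

/-- The index set `[n-1] ∪ {-1}` (for `n ≥ 2`). -/
abbrev Idx (n : ℕ) : Type := {k : ℤ // (k = -1 ∨ 1 ≤ k) ∧ |k| < (n : ℤ)}

/-- The index `k` as an element of `[±n]`. -/
def Idx.lo {n : ℕ} (k : Idx n) : PMSet n :=
  ⟨k.1, by have := k.2.1; omega, k.2.2.le⟩

/-- The element `|k| + 1` of `[±n]`; it is `k + 1` for `k ∈ [n-1]`, and `2` for `k = -1`. -/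
def Idx.hi {n : ℕ} (k : Idx n) : PMSet n :=
  ⟨|k.1| + 1, by have := abs_nonneg k.1; omega,
    by rw [abs_of_nonneg (by positivity)]; have := k.2.2; omega⟩

theorem Idx.lo_ne {n : ℕ} (k : Idx n) : k.lo ≠ -k.hi := by
  intro h
  have h1 := congrArg Subtype.val h
  simp only [Idx.lo, Idx.hi, coe_neg] at h1
  have h2 := neg_abs_le k.1
  omega

theorem signProd_idx {n : ℕ} (k : Idx n) : signProd (signedTransp k.lo k.hi) = 1 := by
  have hhi : 0 < k.hi.1 := by
    have := abs_nonneg k.1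
    simp only [Idx.hi]
    omega
  rcases k.2.1 with h | h
  · have hne := k.lo_ne
    have hlo : k.lo.1 = -1 := h
    have hhi2 : k.hi.1 = 2 := by simp only [Idx.hi, h]; norm_num
    have hc : signedTransp k.lo (-k.lo) = Equiv.swap k.lo (-k.lo) * Equiv.swap (-k.lo) k.lo := by
      rw [signedTransp, neg_neg]
    have hflip : Equiv.swap k.lo (-k.lo) ∈ signedPerm n := by
      intro x
      have h1 := neg_ne_self k.lo
      have e1 : -x = -k.lo ↔ x = k.lo := neg_inj
      have e3 : -x = k.lo ↔ x = -k.lo := neg_eq_iff_eq_neg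
      have e4 := neg_neg k.lo
      simp only [Equiv.swap_apply_def]
      grind
    have hfhi : Equiv.swap k.lo (-k.lo) k.hi = k.hi := by
      apply Equiv.swap_apply_of_ne_of_ne
      · intro e
        have := congrArg Subtype.val e
        omega
      · intro e
        have := congrArg Subtype.val e
        simp only [coe_neg] at this
        omega
    have hconj := mul_signedTransp hflip (-k.lo) k.hi
    rw [Equiv.swap_apply_right, hfhi] at hconj
    have hne2 : -k.lo ≠ -k.hi := by
      intro e
      have := congrArg Subtype.val e
      simp only [coe_neg] at this
      omega
    have hp1 := congrArg signProd hconj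
    rw [signProd_mul hflip (signedTransp_mem hne2), signProd_mul (signedTransp_mem hne) hflip,
      signProd_swap (by simp only [coe_neg]; omega) hhi, mul_one] at hp1
    have hsq := signProd_mul hflip hflip
    rw [Equiv.swap_mul_self, signProd_one] at hsq
    generalize signProd (Equiv.swap k.lo (-k.lo)) = u at *
    generalize signProd (signedTransp k.lo k.hi) = v at *
    revert u v
    decide
  · exact signProd_swap (show 0 < k.1 by omega) hhi

/-- The generator `t_k` of the even-signed permutation group: for `k ∈ [n-1]` it exchanges `k`
with `k + 1` and `-k` with `-(k + 1)`, and `t_{-1}` exchanges `-1` with `2` and `1` with `-2`. -/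
def tGen {n : ℕ} (k : Idx n) : evenSignedPerm n :=
  ⟨signedTransp k.lo k.hi,
    mem_evenSignedPerm_iff.mpr ⟨signedTransp_mem k.lo_ne, signProd_idx k⟩⟩

theorem tGen_mul_self {n : ℕ} (k : Idx n) : tGen k * tGen k = 1 :=
  Subtype.ext (signedTransp_mul_self k.lo_ne)

/-! ### The braid group of type D -/

/-- The defining relations of the Artin braid group of type D. -/
inductive BraidRel (n : ℕ) : FreeGroup (Idx n) → FreeGroup (Idx n) → Prop
  | db1 (i j : Idx n) (hi : i.1 = -1) (hj : j.1 = 2) :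
      BraidRel n (.of i * .of j * .of i) (.of j * .of i * .of j)
  | db2 (i j : Idx n) (hi : i.1 = -1) (hj : 1 ≤ j.1) (hj2 : j.1 ≠ 2) :
      BraidRel n (.of i * .of j) (.of j * .of i)
  | db3 (i j : Idx n) (hi : 1 ≤ i.1) (hj : 1 ≤ j.1) (hij : |i.1 - j.1| = 1) :
      BraidRel n (.of i * .of j * .of i) (.of j * .of i * .of j)
  | db4 (i j : Idx n) (hi : 1 ≤ i.1) (hj : 1 ≤ j.1) (hij : 2 ≤ |i.1 - j.1|) :
      BraidRel n (.of i * .of j) (.of j * .of i)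

/-- The Artin braid group `B_n^D` of type D. -/
abbrev BraidD (n : ℕ) : Type :=
  PresentedGroup {w : FreeGroup (Idx n) | ∃ u v, BraidRel n u v ∧ w = u * v⁻¹}

/-- The generator `σ_k` of `B_n^D`. -/
def sigma {n : ℕ} (k : Idx n) : BraidD n := PresentedGroup.of k

theorem braid_of_conj {n : ℕ} {i j : Idx n}
    (h : signedTransp ((tGen i).1 j.lo) ((tGen i).1 j.hi) =
      signedTransp ((tGen j).1 i.lo) ((tGen j).1 i.hi)) :
    tGen i * tGen j * tGen i = tGen j * tGen i * tGen j := by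
  have key : ∀ a b : Idx n, ((tGen a * tGen b * tGen a : evenSignedPerm n) : Equiv.Perm (PMSet n)) =
      signedTransp ((tGen a).1 b.lo) ((tGen a).1 b.hi) := by
    intro a b
    have e := mul_signedTransp (tGen a).2.1 b.lo b.hi
    have e2 : (tGen a).1 * (tGen a).1 = 1 := congrArg Subtype.val (tGen_mul_self a)
    calc (tGen a).1 * (tGen b).1 * (tGen a).1
        = signedTransp ((tGen a).1 b.lo) ((tGen a).1 b.hi) * (tGen a).1 * (tGen a).1 := by
          rw [← e]; rfl
      _ = _ := by rw [mul_assoc, e2, mul_one]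
  exact Subtype.ext (by rw [key, key, h])

theorem comm_of_conj {n : ℕ} {i j : Idx n}
    (h : signedTransp ((tGen i).1 j.lo) ((tGen i).1 j.hi) = signedTransp j.lo j.hi) :
    tGen i * tGen j = tGen j * tGen i := by
  have e := mul_signedTransp (tGen i).2.1 j.lo j.hi
  rw [h] at e
  exact Subtype.ext e

theorem coe_tGen_apply {n : ℕ} (k : Idx n) (x : PMSet n) :
    ((tGen k).1 x : ℤ) = if x.1 = k.1 then |k.1| + 1 else if x.1 = |k.1| + 1 then k.1 else
      if x.1 = -k.1 then -(|k.1| + 1) else if x.1 = -(|k.1| + 1) then -k.1 else x.1 := by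
  have h := congrArg Subtype.val (signedTransp_apply k.lo_ne x)
  refine h.trans ?_
  simp only [apply_ite Subtype.val, Subtype.ext_iff, coe_neg]
  rfl

theorem tGen_rel {n : ℕ} {u v : FreeGroup (Idx n)} (h : BraidRel n u v) :
    FreeGroup.lift (fun k : Idx n => tGen k) u = FreeGroup.lift (fun k : Idx n => tGen k) v := by
  have coe_lo : ∀ k : Idx n, (k.lo : ℤ) = k.1 := fun _ => rfl
  have coe_hi : ∀ k : Idx n, (k.hi : ℤ) = |k.1| + 1 := fun _ => rfl
  cases h with
  | db1 i j hi hj =>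
    simp only [map_mul, FreeGroup.lift_apply_of]
    apply braid_of_conj
    congr 1 <;> apply Subtype.ext <;>
      simp only [coe_tGen_apply, coe_lo, coe_hi, hi, hj] <;> norm_num
  | db2 i j hi hj hj2 =>
    simp only [map_mul, FreeGroup.lift_apply_of]
    have ai : |i.1| = 1 := by rw [hi]; rfl
    have aj : |j.1| = j.1 := abs_of_nonneg (by omega)
    apply comm_of_conj
    by_cases h1 : j.1 = 1
    · rw [← signedTransp_neg j.lo_ne, signedTransp_comm (-j.lo)]
      congr 1 <;> apply Subtype.ext <;>
        simp only [coe_tGen_apply, coe_neg, coe_lo, coe_hi, hi, h1] <;> norm_num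
    · congr 1 <;> apply Subtype.ext <;>
        simp only [coe_tGen_apply, coe_lo, coe_hi, ai, aj] <;> split_ifs <;> omega
  | db3 i j hi hj hij =>
    simp only [map_mul, FreeGroup.lift_apply_of]
    have ai : |i.1| = i.1 := abs_of_nonneg (by omega)
    have aj : |j.1| = j.1 := abs_of_nonneg (by omega)
    apply braid_of_conj
    rcases (abs_eq zero_le_one).mp hij with h1 | h1 <;> congr 1 <;> apply Subtype.ext <;>
      simp only [coe_tGen_apply, coe_lo, coe_hi, ai, aj] <;> split_ifs <;> omega
  | db4 i j hi hj hij =>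
    simp only [map_mul, FreeGroup.lift_apply_of]
    have ai : |i.1| = i.1 := abs_of_nonneg (by omega)
    have aj : |j.1| = j.1 := abs_of_nonneg (by omega)
    apply comm_of_conj
    rcases le_abs.mp hij with h1 | h1 <;> congr 1 <;> apply Subtype.ext <;>
      simp only [coe_tGen_apply, coe_lo, coe_hi, ai, aj] <;> split_ifs <;> omega

/-- The natural projection `π : B_n^D → 𝔖_n^D`, `σ_k ↦ t_k`. -/
def piD (n : ℕ) : BraidD n →* evenSignedPerm n :=
  PresentedGroup.toGroup (f := fun k : Idx n => tGen k) (by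
    rintro w ⟨u, v, h, rfl⟩
    rw [map_mul, map_inv, tGen_rel h, mul_inv_cancel])

/-- The action `ρ` of `B_n^D` on `P_n^D`, factored through the even-signed permutation group. -/
def rhoD (n : ℕ) : BraidD n →* Monoid.End (PD n) := (permAction n).comp (piD n)

/-! ### The semidirect product and the tied monoid -/

/-- The semidirect product `N ⋊_ρ M` of monoids: the set `N × M` with the product
`(b, a)(d, c) = (b ρ_a(d), a c)`. -/
@[ext] structure SemiProd {M N : Type} [Monoid M] [Monoid N] (ρ : M →* Monoid.End N) where
  left : N
  right : M

instance {M N : Type} [Monoid M] [Monoid N] (ρ : M →* Monoid.End N) : Monoid (SemiProd ρ) where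
  mul x y := ⟨x.left * ρ x.right y.left, x.right * y.right⟩
  one := ⟨1, 1⟩
  mul_assoc x y z := SemiProd.ext
    (by
      change x.left * ρ x.right y.left * ρ (x.right * y.right) z.left =
        x.left * ρ x.right (y.left * ρ y.right z.left)
      rw [map_mul ρ, map_mul, mul_assoc]
      rfl)
    (mul_assoc _ _ _)
  one_mul x := SemiProd.ext
    (by
      change 1 * ρ 1 x.left = x.left
      rw [map_one, one_mul]
      rfl)
    (one_mul _)
  mul_one x := SemiProd.ext
    (by
      change x.left * ρ x.right 1 = x.left
      rw [map_one, mul_one])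
    (mul_one _)

/-- The tied monoid `T^D B_n^D = P_n^D ⋊_ρ B_n^D`. -/
abbrev TiedMonoid (n : ℕ) : Type := SemiProd (rhoD n)

/-! ### The presentation -/

/-- The generators: `σ_k`, `σ_k⁻¹` (written `sInv k`) and `θ_k`, for `k ∈ [n-1] ∪ {-1}`. -/
inductive Gen (n : ℕ) : Type
  | s (k : Idx n)
  | sInv (k : Idx n)
  | th (k : Idx n)

/-- The free monoid generator `σ_k`. -/
def gs {n : ℕ} (k : Idx n) : FreeMonoid (Gen n) := .of (.s k)

/-- The free monoid generator `σ_k⁻¹`. -/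
def gi {n : ℕ} (k : Idx n) : FreeMonoid (Gen n) := .of (.sInv k)

/-- The free monoid generator `θ_k`. -/
def gt {n : ℕ} (k : Idx n) : FreeMonoid (Gen n) := .of (.th k)

/-- The defining relations of the tied monoid, between words in the generators: `db0`, …, `db4` are
those of the braid group, `td1`, …, `td7` those that involve the `θ_k`. A relation in which an index
larger than `n - 1` would occur is absent. -/
inductive TiedRel (n : ℕ) : FreeMonoid (Gen n) → FreeMonoid (Gen n) → Prop
  | db0 (i : Idx n) : TiedRel n (gs i * gi i) 1
  | db0i (i : Idx n) : TiedRel n (gi i * gs i) 1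
  | db1 (i j : Idx n) (hi : i.1 = -1) (hj : j.1 = 2) :
      TiedRel n (gs i * gs j * gs i) (gs j * gs i * gs j)
  | db2 (i j : Idx n) (hi : i.1 = -1) (hj : 1 ≤ j.1) (hj2 : j.1 ≠ 2) :
      TiedRel n (gs i * gs j) (gs j * gs i)
  | db3 (i j : Idx n) (hi : 1 ≤ i.1) (hj : 1 ≤ j.1) (hij : |i.1 - j.1| = 1) :
      TiedRel n (gs i * gs j * gs i) (gs j * gs i * gs j)
  | db4 (i j : Idx n) (hi : 1 ≤ i.1) (hj : 1 ≤ j.1) (hij : 2 ≤ |i.1 - j.1|) :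
      TiedRel n (gs i * gs j) (gs j * gs i)
  | td1 (i : Idx n) : TiedRel n (gt i * gt i) (gt i)
  | td2 (i j : Idx n) : TiedRel n (gt i * gt j) (gt j * gt i)
  | td3 (i j : Idx n) (hij : |(|i.1| - |j.1|)| = 1) :
      TiedRel n (gs i * gs j * gt i) (gt j * gs i * gs j)
  | td4 (i j : Idx n) (hij : |(|i.1| - |j.1|)| ≠ 1) : TiedRel n (gs i * gt j) (gt j * gs i)
  | td5 (i j : Idx n) (hij : |(|i.1| - |j.1|)| = 1) :
      TiedRel n (gt i * gt j * gs i) (gt j * gs i * gt j)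
  | td5r (i j : Idx n) (hij : |(|i.1| - |j.1|)| = 1) :
      TiedRel n (gt j * gs i * gt j) (gs i * gt i * gt j)
  | td6 (m i j k : Idx n) (hm : m.1 = -1) (hi : i.1 = 1) (hj : j.1 = 2) (hk : k.1 = 3) :
      TiedRel n (gt m * gt i * gt k * gs j * gs m * gs i * gs j * gt k)
        (gt m * gt i * gt j * gt k * gs j * gs m * gs i * gs j)
  | td7 (i j : Idx n) (hij : |(|i.1| - |j.1|)| = 1) :
      TiedRel n (gs i * gi j * gt i) (gt j * gs i * gi j)

/-- The element of the tied monoid that each generator stands for: `σ_k` and `σ_k⁻¹` are the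
braids, and `θ_k = ε_{k, |k|+1}`, that is `θ_k = ε_{k,k+1}` for `k ∈ [n-1]`, `θ_{-1} = ε_{-1,2}`. -/
def genVal {n : ℕ} : Gen n → TiedMonoid n
  | .s k => ⟨1, sigma k⟩
  | .sInv k => ⟨1, (sigma k)⁻¹⟩
  | .th k => ⟨eps k.lo k.hi k.lo_ne, 1⟩

end TiedD

/-! The relations hold in the tied monoid, so the presented monoid maps onto its generators by
`tmToTied`; the work is to build an inverse. By (DB0)–(DB4) the braid group maps to the units of the
presented monoid and acts on it by conjugation. It then suffices to find there a multiplicative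
image `φ` of P_n^D on which conjugation acts through `ρ`: the inverse sends (I, w) to `φ I` times w.

One tie `E a b` is needed for every pair with a ≠ ±b. Up to exchanging a, b or negating both, such
pairs are the positive roots of D_n, and θ_k belongs to the k-th simple root. A tie is attached to
any root by descending through simple reflections that lower the height. That the result does not
depend on the descent is a diamond argument (`TiedAction.rootElt_unique`), resting on the braid
relations, (TD3), (TD4) and (TD7). Together (TD3) and (TD7) say that σ_j² commutes with θ_i for
adjacent i, j; this makes conjugation permute the ties as the even-signed permutations permute the
roots (`TiedAction.exists_family`).

Even-signed permutations move up to four elements with distinct absolute values to ±1, 2, 3, 4. By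
equivariance, relations between ties thus reduce to relations between generators: (TD1) gives
idempotence, (TD2) commutation, (TD5) transitivity (`mul_eq_mul`) and (TD6) the fusion of two zero
blocks (`zero_absorb`).

Consequently the ties absorbed by a given element x, those with `E a b * x = x`, are exactly the
ties of a D_n-partition (`exists_absorbed`). Let `φ I` be the product of the ties of I. Then `φ I *
φ J` absorbs the ties of I and of J, hence those of the least D_n-partition above both, which is the
product I J. This gives multiplicativity, and equivariance of `φ` follows from that of the ties. -/

namespace TiedD

/-! ### Positive roots of type D

The pair `(a, b)` with `|a| < b ≤ n` stands for the positive root `e_a - e_b`, where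
`e_{-a} = -e_a`; the simple roots are `(k, |k| + 1)`. -/

/-- Coordinate of `e_x` in direction `y`. -/
def coordD (x y : ℤ) : ℤ := (if x = y then 1 else 0) - (if x = -y then 1 else 0)

/-- Pairing of the root `β` with `e_y`. -/
def rootCoord (β : ℤ × ℤ) (y : ℤ) : ℤ := coordD β.1 y - coordD β.2 y

/-- Pairing of the root `β` with the simple root of index `k`. -/
def rootPair (β : ℤ × ℤ) (k : ℤ) : ℤ := rootCoord β k - rootCoord β (|k| + 1)

/-- The action of `t_k` on integers. -/
def reflInt (k x : ℤ) : ℤ :=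
  if x = k then |k| + 1 else if x = |k| + 1 then k else
    if x = -k then -(|k| + 1) else if x = -(|k| + 1) then -k else x

/-- The action of `t_k` on positive roots up to sign. -/
def rootRefl (k : ℤ) (β : ℤ × ℤ) : ℤ × ℤ :=
  -- The two exceptions are the simple root, which the reflection negates, and a root orthogonal to
  -- it; in both, applying `reflInt` entrywise would leave the normal form |a| < b.
  if (β.1 = k ∨ β.1 = -k) ∧ β.2 = |k| + 1 then β else (reflInt k β.1, reflInt k β.2)

/-- The height of a positive root. -/
def rootHeight (β : ℤ × ℤ) : ℤ := if β.1 < 0 then β.2 - β.1 - 2 else β.2 - β.1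

/-- The simple root of index `k`. -/
def simpleRoot (k : ℤ) : ℤ × ℤ := (k, |k| + 1)

/-- The positive roots of type `D_n`. -/
def IsPosRoot (n : ℕ) (β : ℤ × ℤ) : Prop := β.1 ≠ 0 ∧ |β.1| < β.2 ∧ β.2 ≤ n

/-- Adjacency in the Coxeter graph of type D. -/
def AdjD (i j : ℤ) : Prop := |(|i| - |j|)| = 1

theorem AdjD.symm {i j : ℤ} (h : AdjD i j) : AdjD j i := by
  unfold AdjD at *; rwa [abs_sub_comm]

variable {n : ℕ}

theorem Idx.cases (k : Idx n) : (k.1 = -1 ∧ |k.1| = 1 ∧ 1 < n) ∨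
    (1 ≤ k.1 ∧ |k.1| = k.1 ∧ k.1 < n) := by
  rcases k with ⟨k, hk, hn⟩
  rcases hk with rfl | hk
  · left; simp at hn ⊢; exact hn
  · right
    have e : |k| = k := abs_of_nonneg (by omega)
    exact ⟨hk, e, by simpa only [e] using hn⟩

theorem isPosRoot_simpleRoot (k : Idx n) : IsPosRoot n (simpleRoot k.1) := by
  rcases k.cases with ⟨h, h', h''⟩ | ⟨h, h', h''⟩ <;> simp only [IsPosRoot, simpleRoot, h'] <;> omega

theorem isPosRoot_rootRefl {β : ℤ × ℤ} (hβ : IsPosRoot n β) (k : Idx n) :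
    IsPosRoot n (rootRefl k.1 β) := by
  rcases β with ⟨a, b⟩
  obtain ⟨h1, h2, h3⟩ := hβ
  rw [abs_lt] at h2
  simp only [IsPosRoot, abs_lt]
  obtain ⟨k, rfl | hk, hn⟩ := k
  · simp only [rootRefl, reflInt, abs_neg, abs_one] at *
    grind (splits := 20)
  · have e : |k| = k := abs_of_nonneg (by omega)
    simp only [rootRefl, reflInt, e] at *
    grind (splits := 20)

/-- The system is simply laced: distinct positive roots pair to -1, 0 or 1. -/
theorem rootPair_cases {β : ℤ × ℤ} (hβ : IsPosRoot n β) (k : Idx n) :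
    rootPair β k.1 = -1 ∨ rootPair β k.1 = 0 ∨ rootPair β k.1 = 1 ∨
      (rootPair β k.1 = 2 ∧ β = simpleRoot k.1) := by
  rcases β with ⟨a, b⟩
  obtain ⟨h1, h2, h3⟩ := hβ
  rw [abs_lt] at h2
  obtain ⟨k, rfl | hk, hn⟩ := k
  · simp only [rootPair, rootCoord, coordD, simpleRoot, Prod.mk.injEq, abs_neg, abs_one] at *
    grind (splits := 20)
  · have e : |k| = k := abs_of_nonneg (by omega)
    simp only [rootPair, rootCoord, coordD, simpleRoot, Prod.mk.injEq, e] at *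
    grind (splits := 20)

theorem rootPair_simpleRoot_self (k : Idx n) : rootPair (simpleRoot k.1) k.1 = 2 := by
  obtain ⟨k, rfl | hk, hn⟩ := k
  · simp only [rootPair, rootCoord, coordD, simpleRoot, abs_neg, abs_one] at *
    grind (splits := 20)
  · have e : |k| = k := abs_of_nonneg (by omega)
    simp only [rootPair, rootCoord, coordD, simpleRoot, e] at *
    grind (splits := 20)

theorem rootRefl_eq_self {β : ℤ × ℤ} (hβ : IsPosRoot n β) (k : Idx n) (h0 : rootPair β k.1 = 0) :
    rootRefl k.1 β = β := by
  rcases β with ⟨a, b⟩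
  obtain ⟨h1, h2, h3⟩ := hβ
  rw [abs_lt] at h2
  obtain ⟨k, rfl | hk, hn⟩ := k
  · simp only [rootRefl, reflInt, rootPair, rootCoord, coordD, abs_neg, abs_one] at *
    grind (splits := 20)
  · have e : |k| = k := abs_of_nonneg (by omega)
    simp only [rootRefl, reflInt, rootPair, rootCoord, coordD, e] at *
    grind (splits := 20)

theorem reflInt_reflInt (k : Idx n) (x : ℤ) : reflInt k.1 (reflInt k.1 x) = x := by
  obtain ⟨k, rfl | hk, hn⟩ := k
  · simp only [reflInt, abs_neg, abs_one] at *
    grind (splits := 20)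
  · have e : |k| = k := abs_of_nonneg (by omega)
    simp only [reflInt, e] at *
    grind (splits := 20)

theorem rootRefl_rootRefl {β : ℤ × ℤ} (hβ : IsPosRoot n β) (k : Idx n) :
    rootRefl k.1 (rootRefl k.1 β) = β := by
  rcases β with ⟨a, b⟩
  obtain ⟨h1, h2, h3⟩ := hβ
  rw [abs_lt] at h2
  obtain ⟨k, rfl | hk, hn⟩ := k
  · simp only [rootRefl, reflInt, abs_neg, abs_one] at *
    grind (splits := 20)
  · have e : |k| = k := abs_of_nonneg (by omega)
    simp only [rootRefl, reflInt, e] at *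
    grind (splits := 20)

/-- An orthogonal involution is self-adjoint. -/
theorem coordD_reflInt (k : Idx n) (x y : ℤ) (hx : x ≠ 0) :
    coordD (reflInt k.1 x) y = coordD x (reflInt k.1 y) := by
  obtain ⟨k, rfl | hk, hn⟩ := k
  · simp only [reflInt, coordD, abs_neg, abs_one] at *
    grind (splits := 20)
  · have e : |k| = k := abs_of_nonneg (by omega)
    simp only [reflInt, coordD, e] at *
    grind (splits := 20)

theorem rootCoord_rootRefl {β : ℤ × ℤ} (hβ : IsPosRoot n β) (k : Idx n)
    (hk : β ≠ simpleRoot k.1) (y : ℤ) :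
    rootCoord (rootRefl k.1 β) y = rootCoord β (reflInt k.1 y) := by
  have h1 := coordD_reflInt k β.1 y hβ.1
  have h2 := coordD_reflInt k β.2 y (by have := hβ.2.1; have := abs_nonneg β.1; omega)
  rcases β with ⟨a, b⟩
  unfold rootRefl
  split_ifs with hc
  · simp only [simpleRoot, ne_eq, Prod.mk.injEq] at *
    clear h1 h2 hβ
    obtain ⟨k, rfl | hk', hn⟩ := k
    · simp only [rootCoord, reflInt, coordD, abs_neg, abs_one] at *
      grind (splits := 20)
    · have e : |k| = k := abs_of_nonneg (by omega)
      simp only [rootCoord, reflInt, coordD, e] at *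
      grind (splits := 20)
  · simp only [rootCoord] at *
    rw [h1, h2]

theorem rootCoord_neg (β : ℤ × ℤ) (y : ℤ) : rootCoord β (-y) = -rootCoord β y := by
  simp only [rootCoord, coordD, neg_neg]; ring

theorem rootPair_rootRefl_self {β : ℤ × ℤ} (hβ : IsPosRoot n β) (s : Idx n)
    (hs : β ≠ simpleRoot s.1) : rootPair (rootRefl s.1 β) s.1 = - rootPair β s.1 := by
  have h1 : reflInt s.1 s.1 = |s.1| + 1 := by simp [reflInt]
  have h2 : reflInt s.1 (|s.1| + 1) = s.1 := by rw [← h1, reflInt_reflInt]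
  simp only [rootPair, rootCoord_rootRefl hβ s hs, h1, h2]
  ring

/-- By self-adjointness the reflection can be moved onto the simple root of `t`, which it sends to
the sum of the two adjacent simple roots. -/
theorem rootPair_rootRefl_of_adj {β : ℤ × ℤ} (hβ : IsPosRoot n β) (s t : Idx n)
    (hs : β ≠ simpleRoot s.1) (hst : AdjD s.1 t.1) :
    rootPair (rootRefl s.1 β) t.1 = rootPair β t.1 + rootPair β s.1 := by
  simp only [rootPair, rootCoord_rootRefl hβ s hs]
  have hn := rootCoord_neg β
  generalize rootCoord β = v at *
  unfold AdjD at hst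
  have e1 := hn 1
  have e2 := hn 2
  have e3 := hn s.1
  have e4 := hn (s.1 + 1)
  clear hn hs
  obtain ⟨s, rfl | hs', hsn⟩ := s <;> obtain ⟨t, rfl | ht', htn⟩ := t
  · simp only [abs_neg, abs_one, sub_self, abs_zero] at hst
    omega
  · have e : |t| = t := abs_of_nonneg (by omega)
    simp only [abs_eq zero_le_one, e, abs_neg, abs_one] at hst
    obtain rfl : t = 2 := by omega
    norm_num [reflInt] at *
  · have e : |s| = s := abs_of_nonneg (by omega)
    simp only [reflInt, abs_eq zero_le_one, e, abs_neg, abs_one] at *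
    grind (splits := 20)
  · have e : |t| = t := abs_of_nonneg (by omega)
    have e' : |s| = s := abs_of_nonneg (by omega)
    simp only [reflInt, abs_eq zero_le_one, e, e'] at *
    grind (splits := 20)

theorem rootPair_rootRefl_of_not_adj {β : ℤ × ℤ} (hβ : IsPosRoot n β) (s t : Idx n)
    (hs : β ≠ simpleRoot s.1) (hst : ¬ AdjD s.1 t.1) (hne : s ≠ t) :
    rootPair (rootRefl s.1 β) t.1 = rootPair β t.1 := by
  simp only [rootPair, rootCoord_rootRefl hβ s hs]
  have hn := rootCoord_neg β
  generalize rootCoord β = v at *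
  rw [ne_eq, Subtype.ext_iff] at hne
  unfold AdjD at hst
  have e1 := hn 1
  have e2 := hn 2
  clear hn hs
  obtain ⟨s, rfl | hs', hsn⟩ := s <;> obtain ⟨t, rfl | ht', htn⟩ := t
  · simp only [reflInt, abs_eq zero_le_one, abs_neg, abs_one] at *
    grind (splits := 20)
  · have e : |t| = t := abs_of_nonneg (by omega)
    simp only [reflInt, abs_eq zero_le_one, e, abs_neg, abs_one] at *
    grind (splits := 20)
  · have e : |s| = s := abs_of_nonneg (by omega)
    simp only [reflInt, abs_eq zero_le_one, e, abs_neg, abs_one] at *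
    grind (splits := 20)
  · have e : |t| = t := abs_of_nonneg (by omega)
    have e' : |s| = s := abs_of_nonneg (by omega)
    simp only [reflInt, abs_eq zero_le_one, e, e'] at *
    grind (splits := 20)

/-- Height is linear with value 1 on simple roots, and reflecting subtracts `rootPair β k` times a
simple root. The 2 subtracted in `rootHeight` for negative first entries gives (-1, 2) height 1. -/
theorem rootHeight_rootRefl {β : ℤ × ℤ} (hβ : IsPosRoot n β) (k : Idx n)
    (h0 : β ≠ simpleRoot k.1) : rootHeight (rootRefl k.1 β) = rootHeight β - rootPair β k.1 := by
  rcases β with ⟨a, b⟩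
  obtain ⟨h1, h2, h3⟩ := hβ
  rw [abs_lt] at h2
  obtain ⟨k, rfl | hk, hn⟩ := k
  · simp only [rootRefl, reflInt, rootPair, rootCoord, coordD, rootHeight, simpleRoot, ne_eq, Prod.mk.injEq, abs_neg, abs_one] at *
    grind (splits := 20)
  · have e : |k| = k := abs_of_nonneg (by omega)
    simp only [rootRefl, reflInt, rootPair, rootCoord, coordD, rootHeight, simpleRoot, ne_eq, Prod.mk.injEq, e] at *
    grind (splits := 20)

/-- If a ≤ -2, the index |a| - 1 lowers |a| by one; otherwise the index b - 1 lowers b by one, which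
fails only for simple roots. -/
theorem exists_rootPair_eq_one {β : ℤ × ℤ} (hβ : IsPosRoot n β)
    (h0 : ∀ k : Idx n, β ≠ simpleRoot k.1) : ∃ k : Idx n, rootPair β k.1 = 1 := by
  rcases β with ⟨a, b⟩
  obtain ⟨h1, h2, h3⟩ := hβ
  rw [abs_lt] at h2
  simp only at h1 h2 h3
  by_cases h : a ≤ -2
  · have e : |-a - 1| = -a - 1 := abs_of_nonneg (by omega)
    refine ⟨⟨-a - 1, by omega, by omega⟩, ?_⟩
    simp only [rootPair, rootCoord, coordD, e]
    grind
  · have e : |b - 1| = b - 1 := abs_of_nonneg (by omega)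
    have key : a ≠ b - 1 := by
      intro h
      apply h0 ⟨b - 1, by omega, by omega⟩
      simp only [simpleRoot, e, Prod.mk.injEq]
      omega
    have key2 : a ≠ -(b - 1) := by
      intro h
      apply h0 ⟨-1, by omega, by simp; omega⟩
      simp only [simpleRoot, Prod.mk.injEq, abs_neg, abs_one]
      omega
    refine ⟨⟨b - 1, by omega, by omega⟩, ?_⟩
    simp only [rootPair, rootCoord, coordD, e]
    grind

theorem reflInt_comm (s t : Idx n) (hst : ¬ AdjD s.1 t.1) (x : ℤ) :
    reflInt s.1 (reflInt t.1 x) = reflInt t.1 (reflInt s.1 x) := by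
  unfold AdjD at hst
  obtain ⟨s, rfl | hs', hsn⟩ := s <;> obtain ⟨t, rfl | ht', htn⟩ := t
  · rfl
  · have e : |t| = t := abs_of_nonneg (by omega)
    simp only [reflInt, abs_eq zero_le_one, e, abs_neg, abs_one] at *
    grind (splits := 20)
  · have e : |s| = s := abs_of_nonneg (by omega)
    simp only [reflInt, abs_eq zero_le_one, e, abs_neg, abs_one] at *
    grind (splits := 20)
  · have e : |t| = t := abs_of_nonneg (by omega)
    have e' : |s| = s := abs_of_nonneg (by omega)
    simp only [reflInt, abs_eq zero_le_one, e, e'] at *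
    grind (splits := 20)

/-- The exceptional roots of `rootRefl` have pairing 2 or 0, so a lowering reflection acts
entrywise. -/
theorem rootRefl_of_rootPair_eq_one {γ : ℤ × ℤ} {k : Idx n} (h : rootPair γ k.1 = 1) :
    rootRefl k.1 γ = (reflInt k.1 γ.1, reflInt k.1 γ.2) := by
  rcases γ with ⟨a, b⟩
  unfold rootRefl
  rw [if_neg]
  rintro ⟨h1, h2⟩
  obtain ⟨k, rfl | hk, hn⟩ := k
  · simp only [rootPair, rootCoord, coordD, abs_neg, abs_one] at *
    grind (splits := 20)
  · have e : |k| = k := abs_of_nonneg (by omega)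
    simp only [rootPair, rootCoord, coordD, e] at *
    grind (splits := 20)

theorem rootRefl_comm {β : ℤ × ℤ} (hβ : IsPosRoot n β) (s t : Idx n) (hst : ¬ AdjD s.1 t.1)
    (hs : rootPair β s.1 = 1) (ht : rootPair β t.1 = 1) :
    rootRefl s.1 (rootRefl t.1 β) = rootRefl t.1 (rootRefl s.1 β) := by
  by_cases hne : s = t
  · rw [hne]
  have n1 : β ≠ simpleRoot s.1 := by
    rintro rfl; rw [rootPair_simpleRoot_self] at hs; omega
  have n2 : β ≠ simpleRoot t.1 := by
    rintro rfl; rw [rootPair_simpleRoot_self] at ht; omega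
  have h1 := rootPair_rootRefl_of_not_adj hβ s t n1 hst hne
  have h2 := rootPair_rootRefl_of_not_adj hβ t s n2 (fun h => hst h.symm) (Ne.symm hne)
  rw [ht] at h1
  rw [hs] at h2
  rw [rootRefl_of_rootPair_eq_one h1, rootRefl_of_rootPair_eq_one h2,
    rootRefl_of_rootPair_eq_one hs, rootRefl_of_rootPair_eq_one ht]
  simp only [reflInt_comm s t hst]

theorem rootPair_simpleRoot_of_adj (s t : Idx n) (h : AdjD s.1 t.1) :
    rootPair (simpleRoot s.1) t.1 = -1 := by
  unfold AdjD at h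
  obtain ⟨s, rfl | hs', hsn⟩ := s <;> obtain ⟨t, rfl | ht', htn⟩ := t
  · simp only [rootPair, rootCoord, coordD, simpleRoot, abs_eq zero_le_one, abs_neg, abs_one] at *
    grind (splits := 20)
  · have e : |t| = t := abs_of_nonneg (by omega)
    simp only [rootPair, rootCoord, coordD, simpleRoot, abs_eq zero_le_one, e, abs_neg, abs_one] at *
    grind (splits := 20)
  · have e : |s| = s := abs_of_nonneg (by omega)
    simp only [rootPair, rootCoord, coordD, simpleRoot, abs_eq zero_le_one, e, abs_neg, abs_one] at *
    grind (splits := 20)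
  · have e : |t| = t := abs_of_nonneg (by omega)
    have e' : |s| = s := abs_of_nonneg (by omega)
    simp only [rootPair, rootCoord, coordD, simpleRoot, abs_eq zero_le_one, e, e'] at *
    grind (splits := 20)

theorem rootPair_simpleRoot_of_not_adj (s t : Idx n) (hst : ¬ AdjD s.1 t.1) (hne : s ≠ t) :
    rootPair (simpleRoot s.1) t.1 = 0 := by
  unfold AdjD at hst
  rw [ne_eq, Subtype.ext_iff] at hne
  obtain ⟨s, rfl | hs', hsn⟩ := s <;> obtain ⟨t, rfl | ht', htn⟩ := t
  · simp only [rootPair, rootCoord, coordD, simpleRoot, abs_eq zero_le_one, abs_neg, abs_one] at *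
    grind (splits := 20)
  · have e : |t| = t := abs_of_nonneg (by omega)
    simp only [rootPair, rootCoord, coordD, simpleRoot, abs_eq zero_le_one, e, abs_neg, abs_one] at *
    grind (splits := 20)
  · have e : |s| = s := abs_of_nonneg (by omega)
    simp only [rootPair, rootCoord, coordD, simpleRoot, abs_eq zero_le_one, e, abs_neg, abs_one] at *
    grind (splits := 20)
  · have e : |t| = t := abs_of_nonneg (by omega)
    have e' : |s| = s := abs_of_nonneg (by omega)
    simp only [rootPair, rootCoord, coordD, simpleRoot, abs_eq zero_le_one, e, e'] at *
    grind (splits := 20)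

theorem simpleRoot_injective {s t : Idx n} (h : simpleRoot s.1 = simpleRoot t.1) : s = t :=
  Subtype.ext (congrArg Prod.fst h)

theorem rootHeight_pos {β : ℤ × ℤ} (hβ : IsPosRoot n β) : 0 < rootHeight β := by
  rcases β with ⟨a, b⟩
  obtain ⟨h1, h2, h3⟩ := hβ
  rw [abs_lt] at h2
  simp only [rootHeight] at *
  grind

/-! ### The elements attached to the roots -/

theorem not_adjD_self (k : ℤ) : ¬ AdjD k k := by simp [AdjD]

/-- The relations between elements `s k` of a group and points `θ k` of a set on which it acts
that propagate `θ` to a family indexed by all the roots. -/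
structure TiedAction {n : ℕ} {G X : Type*} [Group G] [MulAction G X] (s : Idx n → G)
    (θ : Idx n → X) : Prop where
  braid : ∀ i j : Idx n, AdjD i.1 j.1 → s i * s j * s i = s j * s i * s j
  comm : ∀ i j : Idx n, ¬ AdjD i.1 j.1 → s i * s j = s j * s i
  fix : ∀ i j : Idx n, ¬ AdjD i.1 j.1 → s i • θ j = θ j
  swap : ∀ i j : Idx n, AdjD i.1 j.1 → s i • s j • θ i = θ j
  swap_inv : ∀ i j : Idx n, AdjD i.1 j.1 → s i • (s j)⁻¹ • θ i = θ j

/-- `x` is obtained from some `θ k` along a chain of reflections that descends from the root `β`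
to the simple root of index `k`. -/
inductive RootElt {n : ℕ} {G X : Type*} [Group G] [MulAction G X] (s : Idx n → G)
    (θ : Idx n → X) : ℤ × ℤ → X → Prop
  | simple (k : Idx n) : RootElt s θ (simpleRoot k.1) (θ k)
  | step (k : Idx n) (β : ℤ × ℤ) (x : X) (hk : rootPair β k.1 = 1)
      (hx : RootElt s θ (rootRefl k.1 β) x) : RootElt s θ β (s k • x)

theorem ne_simpleRoot_of_rootPair {β : ℤ × ℤ} {k : Idx n} (h : rootPair β k.1 ≠ 2) :
    β ≠ simpleRoot k.1 := by
  rintro rfl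
  exact h (rootPair_simpleRoot_self k)

theorem rootHeight_lower {β : ℤ × ℤ} (hβ : IsPosRoot n β) {k : Idx n} (h : rootPair β k.1 = 1) :
    rootHeight (rootRefl k.1 β) < rootHeight β := by
  rw [rootHeight_rootRefl hβ k (ne_simpleRoot_of_rootPair (by omega))]
  omega

theorem rootPair_simpleRoot_ne_one (i k : Idx n) : rootPair (simpleRoot i.1) k.1 ≠ 1 := by
  by_cases h : i = k
  · rw [h, rootPair_simpleRoot_self]; omega
  · by_cases h' : AdjD i.1 k.1
    · rw [rootPair_simpleRoot_of_adj i k h']; omega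
    · rw [rootPair_simpleRoot_of_not_adj i k h' h]; omega

section

variable {G X : Type*} [Group G] [MulAction G X] {s : Idx n → G} {θ : Idx n → X}

theorem rootElt_cases {β : ℤ × ℤ} {x : X} (h : RootElt s θ β x) :
    (∃ k : Idx n, β = simpleRoot k.1 ∧ x = θ k) ∨
      ∃ (k : Idx n) (y : X), rootPair β k.1 = 1 ∧ RootElt s θ (rootRefl k.1 β) y ∧ x = s k • y := by
  cases h with
  | simple k => exact Or.inl ⟨k, rfl, rfl⟩
  | step k β x hk hx => exact Or.inr ⟨k, x, hk, hx, rfl⟩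

theorem exists_rootElt (s : Idx n → G) (θ : Idx n → X) {β : ℤ × ℤ} (hβ : IsPosRoot n β) :
    ∃ x, RootElt s θ β x := by
  induction h : (rootHeight β).toNat using Nat.strong_induction_on generalizing β with
  | _ N ih =>
    by_cases h0 : ∃ k : Idx n, β = simpleRoot k.1
    · obtain ⟨k, rfl⟩ := h0
      exact ⟨_, .simple k⟩
    · push Not at h0
      obtain ⟨k, hk⟩ := exists_rootPair_eq_one hβ h0
      have hr := isPosRoot_rootRefl hβ k
      have h1 := rootHeight_lower hβ hk
      have h2 := rootHeight_pos hr
      obtain ⟨x, hx⟩ := ih _ (by omega) hr rfl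
      exact ⟨_, .step k β x hk hx⟩

namespace TiedAction

variable (H : TiedAction s θ)
include H

/-- Cancelling `s i` between (TD3) and (TD7) shows that the square of `s j` fixes `θ i`. -/
theorem smul_eq_inv_smul {i j : Idx n} (h : AdjD i.1 j.1) : s j • θ i = (s j)⁻¹ • θ i := by
  have h1 := H.swap i j h
  have h2 := H.swap_inv i j h
  exact smul_left_cancel _ (h1.trans h2.symm)

/-- The sum of two adjacent simple roots has two descents; this is their agreement. -/
theorem smul_comm_of_adj {i j : Idx n} (h : AdjD i.1 j.1) : s i • θ j = s j • θ i := by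
  rw [H.smul_eq_inv_smul h.symm, ← H.swap i j h, inv_smul_smul]

/-- Diamond argument by induction on the height: two different first steps are compared inside the
rank two system they span. -/
theorem rootElt_unique {β : ℤ × ℤ} (hβ : IsPosRoot n β) {x y : X} (hx : RootElt s θ β x)
    (hy : RootElt s θ β y) : x = y := by
  induction h : (rootHeight β).toNat using Nat.strong_induction_on generalizing β x y with
  | _ N ih =>
    have low : ∀ {k : Idx n}, rootPair β k.1 = 1 → ∀ {x y : X}, RootElt s θ (rootRefl k.1 β) x →
        RootElt s θ (rootRefl k.1 β) y → x = y := by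
      intro k hk x y hx hy
      have hr := isPosRoot_rootRefl hβ k
      have h1 := rootHeight_lower hβ hk
      have h2 := rootHeight_pos hr
      exact ih _ (by omega) hr hx hy rfl
    replace hx := rootElt_cases hx
    replace hy := rootElt_cases hy
    rcases hx with ⟨i, hi, rfl⟩ | ⟨i, x, hi, hx, rfl⟩ <;>
      rcases hy with ⟨j, hj, rfl⟩ | ⟨j, y, hj, hy, rfl⟩
    · rw [simpleRoot_injective (hi.symm.trans hj)]
    · rw [hi] at hj
      exact absurd hj (rootPair_simpleRoot_ne_one i j)
    · rw [hj] at hi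
      exact absurd hi (rootPair_simpleRoot_ne_one j i)
    · by_cases hij : i = j
      · subst hij
        rw [low hi hx hy]
      have ni := ne_simpleRoot_of_rootPair (k := i) (β := β) (by omega)
      have nj := ne_simpleRoot_of_rootPair (k := j) (β := β) (by omega)
      by_cases ha : AdjD i.1 j.1
      -- Lowering by one of two adjacent descents gives pairing 1 + 1 = 2 with the other, so the
      -- lowered root is the other simple root.
      · have e : ∀ {a b : Idx n}, AdjD a.1 b.1 → rootPair β a.1 = 1 → rootPair β b.1 = 1 →
            ∀ {x : X}, RootElt s θ (rootRefl a.1 β) x → x = θ b := by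
          intro a b hab ha1 hb1 x hx
          have h1 := rootPair_rootRefl_of_adj hβ a b (ne_simpleRoot_of_rootPair (by omega)) hab
          have h2 := rootPair_cases (isPosRoot_rootRefl hβ a) b
          have h3 : rootRefl a.1 β = simpleRoot b.1 := by
            rcases h2 with h2 | h2 | h2 | h2
            · omega
            · omega
            · omega
            · exact h2.2
          exact low ha1 hx (h3 ▸ .simple b)
        rw [e ha hi hj hx, e ha.symm hj hi hy, H.smul_comm_of_adj ha]
      · have h1 := rootPair_rootRefl_of_not_adj hβ i j ni ha hij
        have h2 := rootPair_rootRefl_of_not_adj hβ j i nj (fun h => ha h.symm) (Ne.symm hij)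
        -- The two commuting descents meet at a root below both; its element `z` is reached from
        -- either side.
        obtain ⟨z, hz⟩ := exists_rootElt s θ
          (isPosRoot_rootRefl (isPosRoot_rootRefl hβ i) j)
        have hz' := hz
        rw [← rootRefl_comm hβ i j ha hi hj] at hz'
        rw [low hi hx (.step j _ z (h1.trans hj) hz), low hj hy (.step i _ z (h2.trans hi) hz'),
          smul_smul, smul_smul, H.comm i j ha]

/-- Induction along a descent i. If i and k are adjacent, descending by i and then k reaches a root
orthogonal to i, whose element is fixed by `s i`; the braid relation carries this to `s k` at the
top. -/
theorem smul_of_rootPair_eq_zero {β : ℤ × ℤ} (hβ : IsPosRoot n β) {x : X} (hx : RootElt s θ β x)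
    {k : Idx n} (hk : rootPair β k.1 = 0) : s k • x = x := by
  induction h : (rootHeight β).toNat using Nat.strong_induction_on generalizing β x k with
  | _ N ih =>
    replace hx := rootElt_cases hx
    rcases hx with ⟨i, rfl, rfl⟩ | ⟨i, x, hi, hx, rfl⟩
    · apply H.fix
      intro ha
      rw [rootPair_simpleRoot_of_adj i k ha.symm] at hk
      omega
    · have hr := isPosRoot_rootRefl hβ i
      have h1 := rootHeight_lower hβ hi
      have h2 := rootHeight_pos hr
      have ni := ne_simpleRoot_of_rootPair (k := i) (β := β) (by omega)
      have hik : i ≠ k := by rintro rfl; omega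
      by_cases ha : AdjD i.1 k.1
      · have h3 := rootPair_rootRefl_of_adj hβ i k ni ha
        have h4 := rootPair_rootRefl_self hβ i ni
        have h5 : rootPair (rootRefl i.1 β) k.1 = 1 := by omega
        have h6 := rootPair_rootRefl_of_adj hr k i (ne_simpleRoot_of_rootPair (by omega)) ha.symm
        have h7 := rootHeight_lower hr h5
        have hr' := isPosRoot_rootRefl hr k
        have h8 := rootHeight_pos hr'
        obtain ⟨z, hz⟩ := exists_rootElt s θ hr'
        obtain rfl := H.rootElt_unique hr hx (.step k _ z h5 hz)
        have h9 : s i • z = z := ih _ (by omega) hr' hz (by omega) rfl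
        calc s k • s i • s k • z = (s k * s i * s k) • z := by simp only [mul_smul]
          _ = (s i * s k * s i) • z := by rw [H.braid k i ha.symm]
          _ = s i • s k • z := by simp only [mul_smul, h9]
      · have h3 := rootPair_rootRefl_of_not_adj hβ i k ni ha hik
        have h4 : s k • x = x := ih _ (by omega) hr hx (h3.trans hk) rfl
        rw [smul_smul, ← H.comm i k ha, ← smul_smul, h4]

/-- Squares of generators must act trivially for the action to factor through reflections. For a
descent i adjacent to k, the lower element is fixed by `s k` (pairing 0) and by the square of `s i`
(pairing -1, induction); two braid moves finish. -/
theorem smul_smul_of_rootPair_eq_neg_one {β : ℤ × ℤ} (hβ : IsPosRoot n β) {x : X}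
    (hx : RootElt s θ β x) {k : Idx n} (hk : rootPair β k.1 = -1) : s k • s k • x = x := by
  induction h : (rootHeight β).toNat using Nat.strong_induction_on generalizing β x k with
  | _ N ih =>
    replace hx := rootElt_cases hx
    rcases hx with ⟨i, rfl, rfl⟩ | ⟨i, x, hi, hx, rfl⟩
    · have ha : AdjD i.1 k.1 := by
        by_contra ha
        by_cases hik : i = k
        · rw [hik, rootPair_simpleRoot_self] at hk
          omega
        · rw [rootPair_simpleRoot_of_not_adj i k ha hik] at hk
          omega
      rw [H.smul_eq_inv_smul ha, smul_inv_smul]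
    · have hr := isPosRoot_rootRefl hβ i
      have h1 := rootHeight_lower hβ hi
      have h2 := rootHeight_pos hr
      have ni := ne_simpleRoot_of_rootPair (k := i) (β := β) (by omega)
      have hik : i ≠ k := by rintro rfl; omega
      by_cases ha : AdjD i.1 k.1
      · have h3 := rootPair_rootRefl_of_adj hβ i k ni ha
        have h4 := rootPair_rootRefl_self hβ i ni
        have h5 : s k • x = x := H.smul_of_rootPair_eq_zero hr hx (by omega)
        have h6 : s i • s i • x = x := ih _ (by omega) hr hx (by omega) rfl
        have h7 : s k • s i • x = s i • s k • s i • x := by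
          calc s k • s i • x = (s k * s i * s k) • x := by simp only [mul_smul, h5]
            _ = (s i * s k * s i) • x := by rw [H.braid k i ha.symm]
            _ = _ := by simp only [mul_smul]
        calc s k • s k • s i • x = (s k * s i * s k) • s i • x := by rw [h7]; simp only [mul_smul]
          _ = (s i * s k * s i) • s i • x := by rw [H.braid k i ha.symm]
          _ = s i • x := by simp only [mul_smul, h6, h5]
      · have h3 := rootPair_rootRefl_of_not_adj hβ i k ni ha hik
        have h4 : s k • s k • x = x := ih _ (by omega) hr hx (h3.trans hk) rfl
        have h5 : ∀ y : X, s k • s i • y = s i • s k • y := fun y => by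
          rw [smul_smul, ← H.comm i k ha, ← smul_smul]
        rw [h5, h5, h4]

/-- The points `θ k` extend to an equivariant family indexed by the positive roots. -/
theorem exists_family [Nonempty X] : ∃ F : ℤ × ℤ → X, (∀ k : Idx n, F (simpleRoot k.1) = θ k) ∧
    ∀ (k : Idx n) (β : ℤ × ℤ), IsPosRoot n β → s k • F β = F (rootRefl k.1 β) := by
  classical
  have ex : ∀ β : ℤ × ℤ, ∃ x, IsPosRoot n β → RootElt s θ β x := by
    intro β
    by_cases hβ : IsPosRoot n β
    · obtain ⟨x, hx⟩ := exists_rootElt s θ hβ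
      exact ⟨x, fun _ => hx⟩
    · exact ⟨Classical.arbitrary X, fun h => absurd h hβ⟩
  choose F hF using ex
  refine ⟨F, fun k => H.rootElt_unique (isPosRoot_simpleRoot k) (hF _ (isPosRoot_simpleRoot k))
    (.simple k), fun k β hβ => ?_⟩
  have hr := isPosRoot_rootRefl hβ k
  -- Pairing -1 is a descent read upwards; pairing 1 applies `s k` twice to the lower element; for
  -- pairings 0 and 2 both the root and its element are fixed.
  rcases rootPair_cases hβ k with h | h | h | ⟨h, rfl⟩
  · refine H.rootElt_unique hr (.step k _ _ ?_ ?_) (hF _ hr)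
    · rw [rootPair_rootRefl_self hβ k (ne_simpleRoot_of_rootPair (by omega)), h]
      rfl
    · rw [rootRefl_rootRefl hβ]
      exact hF _ hβ
  · rw [rootRefl_eq_self hβ k h, H.smul_of_rootPair_eq_zero hβ (hF _ hβ) h]
  · rw [H.rootElt_unique hβ (hF _ hβ) (.step k _ _ h (hF _ hr))]
    refine H.smul_smul_of_rootPair_eq_neg_one hr (hF _ hr) ?_
    rw [rootPair_rootRefl_self hβ k (ne_simpleRoot_of_rootPair (by omega)), h]
  · have e : rootRefl k.1 (simpleRoot k.1) = simpleRoot k.1 := by simp [rootRefl, simpleRoot]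
    rw [e, H.rootElt_unique hβ (hF _ hβ) (.simple k)]
    exact H.fix k k (not_adjD_self _)

end TiedAction

end

/-! ### Partitions `ε_{a,b}` and the action on them -/

/-- With `PD.mul_le_iff` and `PD.eq_of_forall_le`, this turns identities between products of ε's
into equivalences inside an arbitrary D_n-partition. -/
theorem eps_le_iff {a b : PMSet n} (h : a ≠ -b) {K : PD n} : (eps a b h).1 ≤ K.1 ↔ K.1 a b := by
  constructor
  · intro hK
    exact hK (Or.inr (Or.inl ⟨Or.inl rfl, Or.inr rfl⟩))
  · intro hK x y hxy
    have hn := K.2.signed _ _ hK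
    rcases hxy with rfl | ⟨rfl | rfl, rfl | rfl⟩ | ⟨rfl | rfl, rfl | rfl⟩
    · exact K.1.refl _
    · exact K.1.refl _
    · exact hK
    · exact K.1.symm hK
    · exact K.1.refl _
    · exact K.1.refl _
    · exact hn
    · exact K.1.symm hn
    · exact K.1.refl _

theorem PD.rel_comm (K : PD n) (a b : PMSet n) : K.1 a b ↔ K.1 b a := ⟨K.1.symm, K.1.symm⟩

theorem eps_swap {a b : PMSet n} (h : a ≠ -b) (h' : b ≠ -a) : eps a b h = eps b a h' :=
  PD.eq_of_forall_le fun K => by rw [eps_le_iff, eps_le_iff, K.rel_comm]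

theorem eps_neg {a b : PMSet n} (h : a ≠ -b) (h' : -a ≠ -(-b)) : eps (-a) (-b) h' = eps a b h :=
  PD.eq_of_forall_le fun K => by
    rw [eps_le_iff, eps_le_iff]
    refine ⟨fun hK => ?_, K.2.signed _ _⟩
    simpa using K.2.signed _ _ hK

theorem perm_ne_neg {t : Equiv.Perm (PMSet n)} (ht : t ∈ signedPerm n) {a b : PMSet n}
    (h : a ≠ -b) : t a ≠ -t b := by
  rw [← ht]
  exact t.injective.ne h

theorem permPD_eps {t : Equiv.Perm (PMSet n)} (ht : t ∈ signedPerm n) {a b : PMSet n}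
    (h : a ≠ -b) : permPD t ht (eps a b h) = eps (t a) (t b) (perm_ne_neg ht h) :=
  PD.eq_of_forall_le fun K => by
    rw [permPD_le_iff, eps_le_iff, eps_le_iff]
    change K.1 (t⁻¹⁻¹ a) (t⁻¹⁻¹ b) ↔ _
    rw [inv_inv]

theorem rhoD_apply (w : BraidD n) (I : PD n) :
    rhoD n w I = permPD (piD n w).1 (piD n w).2.1 I := rfl

theorem rhoD_eps (w : BraidD n) {a b : PMSet n} (h : a ≠ -b) :
    rhoD n w (eps a b h) =
      eps ((piD n w).1 a) ((piD n w).1 b) (perm_ne_neg (piD n w).2.1 h) := by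
  rw [rhoD_apply, permPD_eps]

theorem piD_sigma (k : Idx n) : piD n (sigma k) = tGen k := PresentedGroup.toGroup.of _

theorem piD_sigma_inv (k : Idx n) : piD n (sigma k)⁻¹ = tGen k := by
  rw [map_inv, piD_sigma, inv_eq_of_mul_eq_one_right (tGen_mul_self k)]

theorem coe_tGen_eq_reflInt (k : Idx n) (x : PMSet n) :
    ((tGen k).1 x : ℤ) = reflInt k.1 x.1 := coe_tGen_apply k x

/-! ### Relations in the braid group -/

theorem mk_eq_of_braidRel {u v : FreeGroup (Idx n)} (h : BraidRel n u v) :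
    PresentedGroup.mk {w : FreeGroup (Idx n) | ∃ u v, BraidRel n u v ∧ w = u * v⁻¹} u =
      PresentedGroup.mk _ v := by
  have h1 := PresentedGroup.one_of_mem (rels := {w : FreeGroup (Idx n) | ∃ u v, BraidRel n u v ∧
    w = u * v⁻¹}) (x := u * v⁻¹) ⟨u, v, h, rfl⟩
  rw [map_mul, map_inv] at h1
  exact mul_inv_eq_one.mp h1

/-- Relations on adjacent indices follow from (DB1) and (DB3). -/
theorem adjD_induction {P : Idx n → Idx n → Prop} (hs : ∀ i j, P i j → P j i)
    (h1 : ∀ i j : Idx n, i.1 = -1 → j.1 = 2 → P i j)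
    (h2 : ∀ i j : Idx n, 1 ≤ i.1 → 1 ≤ j.1 → |i.1 - j.1| = 1 → P i j) (i j : Idx n)
    (h : AdjD i.1 j.1) : P i j := by
  unfold AdjD at h
  rcases i.cases with ⟨hi, hi', -⟩ | ⟨hi, hi', -⟩ <;>
    rcases j.cases with ⟨hj, hj', -⟩ | ⟨hj, hj', -⟩ <;> rw [hi', hj'] at h
  · simp at h
  · exact h1 i j hi (by rcases (abs_eq zero_le_one).mp h with h | h <;> omega)
  · exact hs _ _ (h1 j i hj (by rcases (abs_eq zero_le_one).mp h with h | h <;> omega))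
  · exact h2 i j hi hj h

/-- Relations on non adjacent indices follow from (DB2) and (DB4). -/
theorem not_adjD_induction {P : Idx n → Idx n → Prop} (hs : ∀ i j, P i j → P j i)
    (h0 : ∀ i, P i i) (h1 : ∀ i j : Idx n, i.1 = -1 → 1 ≤ j.1 → j.1 ≠ 2 → P i j)
    (h2 : ∀ i j : Idx n, 1 ≤ i.1 → 1 ≤ j.1 → 2 ≤ |i.1 - j.1| → P i j) (i j : Idx n)
    (h : ¬ AdjD i.1 j.1) : P i j := by
  by_cases hij : i = j
  · rw [hij]
    exact h0 j
  rw [Subtype.ext_iff] at hij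
  unfold AdjD at h
  rw [abs_eq zero_le_one] at h
  rcases i.cases with ⟨hi, hi', -⟩ | ⟨hi, hi', -⟩ <;>
    rcases j.cases with ⟨hj, hj', -⟩ | ⟨hj, hj', -⟩ <;> rw [hi', hj'] at h
  · omega
  · exact h1 i j hi hj (by omega)
  · exact hs _ _ (h1 j i hj hi (by omega))
  · exact h2 i j hi hj (by rw [le_abs]; omega)

theorem sigma_braid (i j : Idx n) (h : AdjD i.1 j.1) :
    sigma i * sigma j * sigma i = sigma j * sigma i * sigma j :=
  adjD_induction (P := fun i j => sigma i * sigma j * sigma i = sigma j * sigma i * sigma j)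
    (fun _ _ h => h.symm) (fun i j hi hj => mk_eq_of_braidRel (.db1 i j hi hj))
    (fun i j hi hj h => mk_eq_of_braidRel (.db3 i j hi hj h)) i j h

theorem sigma_comm (i j : Idx n) (h : ¬ AdjD i.1 j.1) :
    sigma i * sigma j = sigma j * sigma i :=
  not_adjD_induction (P := fun i j => sigma i * sigma j = sigma j * sigma i)
    (fun _ _ h => h.symm) (fun _ => rfl)
    (fun i j hi hj h => mk_eq_of_braidRel (.db2 i j hi hj h))
    (fun i j hi hj h => mk_eq_of_braidRel (.db4 i j hi hj h)) i j h

/-! ### The generators satisfy the relations -/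

/-- Two adjacent reflections act as the transpositions `(a b)` and `(b c)` on a chain. -/
theorem exists_chain (i j : Idx n) (h : AdjD i.1 j.1) : ∃ a b c : PMSet n,
    ((i.lo = a ∧ i.hi = b) ∨ (i.lo = b ∧ i.hi = a)) ∧
    ((j.lo = b ∧ j.hi = c) ∨ (j.lo = c ∧ j.hi = b)) ∧ a ≠ -b ∧ b ≠ -c ∧ a ≠ -c ∧
    (tGen i).1 a = b ∧ (tGen i).1 b = a ∧ (tGen i).1 c = c ∧
    (tGen j).1 a = a ∧ (tGen j).1 b = c ∧ (tGen j).1 c = b := by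
  simp only [ne_eq, Subtype.ext_iff, coe_tGen_eq_reflInt, coe_neg, reflInt]
  unfold AdjD at h
  have hlo : ∀ k : Idx n, (k.lo : ℤ) = k.1 := fun _ => rfl
  have hhi : ∀ k : Idx n, (k.hi : ℤ) = |k.1| + 1 := fun _ => rfl
  rcases i.cases with ⟨hi, hi', -⟩ | ⟨hi, hi', -⟩ <;>
    rcases j.cases with ⟨hj, hj', -⟩ | ⟨hj, hj', -⟩ <;> rw [hi', hj', abs_eq zero_le_one] at h
  · omega
  · refine ⟨i.lo, i.hi, j.hi, ?_⟩
    simp only [hlo, hhi, hi', hj']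
    grind (splits := 20)
  · refine ⟨i.hi, i.lo, j.lo, ?_⟩
    simp only [hlo, hhi, hi', hj']
    grind (splits := 20)
  · rcases h with h | h
    · refine ⟨i.hi, i.lo, j.lo, ?_⟩
      simp only [hlo, hhi, hi', hj']
      grind (splits := 20)
    · refine ⟨i.lo, i.hi, j.hi, ?_⟩
      simp only [hlo, hhi, hi', hj']
      grind (splits := 20)

theorem rhoD_sigma_eps (k : Idx n) {a b : PMSet n} (h : a ≠ -b) : rhoD n (sigma k) (eps a b h) =
    eps ((tGen k).1 a) ((tGen k).1 b) (perm_ne_neg (tGen k).2.1 h) := by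
  simp only [rhoD_eps, piD_sigma]

theorem rhoD_sigma_inv_eps (k : Idx n) {a b : PMSet n} (h : a ≠ -b) :
    rhoD n (sigma k)⁻¹ (eps a b h) =
      eps ((tGen k).1 a) ((tGen k).1 b) (perm_ne_neg (tGen k).2.1 h) := by
  simp only [rhoD_eps, piD_sigma_inv]

/-- The partition of `θ_k`. -/
def epsIdx (k : Idx n) : PD n := eps k.lo k.hi k.lo_ne

theorem exists_eps_chain (i j : Idx n) (h : AdjD i.1 j.1) : ∃ (a b c : PMSet n) (hab : a ≠ -b)
    (hbc : b ≠ -c) (_ : a ≠ -c), epsIdx i = eps a b hab ∧ epsIdx j = eps b c hbc ∧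
    (tGen i).1 a = b ∧ (tGen i).1 b = a ∧ (tGen i).1 c = c ∧
    (tGen j).1 a = a ∧ (tGen j).1 b = c ∧ (tGen j).1 c = b := by
  obtain ⟨a, b, c, hi, hj, hab, hbc, hac, ht⟩ := exists_chain i j h
  have key : ∀ (k : Idx n) (x y : PMSet n) (hxy : x ≠ -y),
      ((k.lo = x ∧ k.hi = y) ∨ (k.lo = y ∧ k.hi = x)) → epsIdx k = eps x y hxy := by
    rintro k x y hxy (⟨rfl, rfl⟩ | ⟨rfl, rfl⟩)
    · rfl
    · exact eps_swap _ _
  exact ⟨a, b, c, hab, hbc, hac, key i a b hab hi, key j b c hbc hj, ht⟩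

theorem rhoD_sigma_epsIdx_of_not_adj (i j : Idx n) (h : ¬ AdjD i.1 j.1) :
    rhoD n (sigma i) (epsIdx j) = epsIdx j := by
  -- The second alternative arises when i = j, and the third when i and j are 1 and -1: the
  -- reflections commute but exchange the pair with a change of signs.
  have hc : ((tGen i).1 j.lo = j.lo ∧ (tGen i).1 j.hi = j.hi) ∨
      ((tGen i).1 j.lo = j.hi ∧ (tGen i).1 j.hi = j.lo) ∨
      ((tGen i).1 j.lo = -j.hi ∧ (tGen i).1 j.hi = -j.lo) := by
    simp only [Subtype.ext_iff, coe_tGen_eq_reflInt, coe_neg, reflInt]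
    unfold AdjD at h
    have hlo : ∀ k : Idx n, (k.lo : ℤ) = k.1 := fun _ => rfl
    have hhi : ∀ k : Idx n, (k.hi : ℤ) = |k.1| + 1 := fun _ => rfl
    rcases i.cases with ⟨hi, hi', -⟩ | ⟨hi, hi', -⟩ <;>
      rcases j.cases with ⟨hj, hj', -⟩ | ⟨hj, hj', -⟩ <;> rw [hi', hj', abs_eq zero_le_one] at h <;>
      simp only [hlo, hhi, hi', hj'] <;> grind (splits := 20)
  have hne := j.lo_ne
  have hne' : j.hi ≠ -j.lo := fun h => hne (by rw [h, neg_neg])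
  rw [epsIdx, rhoD_sigma_eps]
  rcases hc with ⟨h1, h2⟩ | ⟨h1, h2⟩ | ⟨h1, h2⟩
  · simp only [h1, h2]
  · simp only [h1, h2]
    exact eps_swap _ _
  · simp only [h1, h2]
    rw [eps_neg hne']
    exact eps_swap _ _

namespace SemiProd

variable {M N : Type} [Monoid M] [Monoid N] (ρ : M →* Monoid.End N)

theorem mul_mk (b d : N) (a c : M) :
    (⟨b, a⟩ : SemiProd ρ) * ⟨d, c⟩ = ⟨b * ρ a d, a * c⟩ := rfl

theorem one_def : (1 : SemiProd ρ) = ⟨1, 1⟩ := rfl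

end SemiProd

theorem lift_gs (k : Idx n) : FreeMonoid.lift (genVal (n := n)) (gs k) = ⟨1, sigma k⟩ := rfl
theorem lift_gi (k : Idx n) : FreeMonoid.lift (genVal (n := n)) (gi k) = ⟨1, (sigma k)⁻¹⟩ := rfl
theorem lift_gt (k : Idx n) : FreeMonoid.lift (genVal (n := n)) (gt k) = ⟨epsIdx k, 1⟩ := rfl

theorem epsIdx_mul_self (k : Idx n) : epsIdx k * epsIdx k = epsIdx k :=
  PD.eq_of_forall_le fun K => by rw [PD.mul_le_iff, and_self]

theorem genVal_rel {u v : FreeMonoid (Gen n)} (h : TiedRel n u v) :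
    FreeMonoid.lift genVal u = FreeMonoid.lift genVal v := by
  have hone : ∀ I : PD n, (1 : Monoid.End (PD n)) I = I := fun I => rfl
  have hcomp : ∀ (f g : Monoid.End (PD n)) (I : PD n), (f * g) I = f (g I) := fun _ _ _ => rfl
  cases h <;> simp only [map_mul, map_one, lift_gs, lift_gi, lift_gt,
    SemiProd.mul_mk, SemiProd.one_def, one_mul, mul_one, hone, hcomp]
  case db0 i => rw [mul_inv_cancel]
  case db0i i => rw [inv_mul_cancel]
  case db1 i j hi hj => rw [sigma_braid i j (by simp [AdjD, hi, hj])]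
  case db2 i j hi hj hj2 =>
    rw [sigma_comm i j]
    unfold AdjD
    rw [hi, abs_of_nonneg (show 0 ≤ j.1 by omega), abs_neg, abs_one, abs_eq zero_le_one]
    omega
  case db3 i j hi hj hij =>
    rw [sigma_braid i j]
    unfold AdjD
    rwa [abs_of_nonneg (show 0 ≤ j.1 by omega), abs_of_nonneg (show 0 ≤ i.1 by omega)]
  case db4 i j hi hj hij =>
    rw [sigma_comm i j]
    unfold AdjD
    rw [abs_of_nonneg (show 0 ≤ j.1 by omega), abs_of_nonneg (show 0 ≤ i.1 by omega)]
    omega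
  case td1 i => rw [epsIdx_mul_self]
  case td2 i j => rw [mul_comm]
  case td3 i j hij =>
    obtain ⟨a, b, c, hab, hbc, hac, h1, h2, t1, t2, t3, t4, t5, t6⟩ := exists_eps_chain i j hij
    rw [h1, h2]
    simp only [rhoD_sigma_eps, t1, t3, t4, t5]
  case td4 i j hij => rw [rhoD_sigma_epsIdx_of_not_adj i j hij]
  case td5 i j hij =>
    obtain ⟨a, b, c, hab, hbc, hac, h1, h2, t1, t2, t3, t4, t5, t6⟩ := exists_eps_chain i j hij
    rw [h1, h2]
    simp only [rhoD_sigma_eps, t2, t3]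
    congr 1
    -- Both products have a, b, c in one block: ε_{a,b} ε_{b,c} = ε_{b,c} ε_{a,c}.
    refine PD.eq_of_forall_le fun K => ?_
    simp only [PD.mul_le_iff, eps_le_iff]
    exact ⟨fun h => ⟨h.2, K.1.trans h.1 h.2⟩, fun h => ⟨K.1.trans h.2 (K.1.symm h.1), h.1⟩⟩
  case td5r i j hij =>
    obtain ⟨a, b, c, hab, hbc, hac, h1, h2, t1, t2, t3, t4, t5, t6⟩ := exists_eps_chain i j hij
    rw [h1, h2]
    simp only [rhoD_sigma_eps, t1, t2, t3]
    congr 1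
    refine PD.eq_of_forall_le fun K => ?_
    simp only [PD.mul_le_iff, eps_le_iff]
    exact ⟨fun h => ⟨K.1.trans h.1 (K.1.symm h.2), h.2⟩, fun h => ⟨K.1.trans h.1 h.2, h.2⟩⟩
  case td6 m i j k hm hi hj hk =>
    congr 1
    have hlo : ∀ k : Idx n, (k.lo : ℤ) = k.1 := fun _ => rfl
    have hhi : ∀ k : Idx n, (k.hi : ℤ) = |k.1| + 1 := fun _ => rfl
    have e1 : m.lo = -i.lo := Subtype.ext (by rw [coe_neg, hlo, hlo, hm, hi])
    have e2 : m.hi = i.hi := Subtype.ext (by rw [hhi, hhi, hm, hi]; rfl)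
    have e3 : j.lo = i.hi := Subtype.ext (by rw [hlo, hhi, hj, hi]; rfl)
    have e4 : k.lo = j.hi := Subtype.ext (by rw [hlo, hhi, hj, hk]; rfl)
    -- The braid σ₂σ₋₁σ₁σ₂ changes the signs of 1 and 3 and fixes 2 and 4, so it turns ε_{3,4} into
    -- ε_{-3,4}.
    have e5 : (tGen j).1 ((tGen m).1 ((tGen i).1 ((tGen j).1 k.lo))) = -k.lo := by
      simp only [Subtype.ext_iff, coe_tGen_eq_reflInt, coe_neg, hlo, hi, hj, hk, hm]
      decide
    have e6 : (tGen j).1 ((tGen m).1 ((tGen i).1 ((tGen j).1 k.hi))) = k.hi := by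
      simp only [Subtype.ext_iff, coe_tGen_eq_reflInt, hhi, hi, hj, hk, hm]
      decide
    refine PD.eq_of_forall_le fun K => ?_
    simp only [epsIdx, rhoD_sigma_eps, PD.mul_le_iff, eps_le_iff, e5, e6]
    rw [e1, e2, e3, e4]
    generalize i.lo = a
    generalize i.hi = b
    generalize j.hi = c
    generalize k.hi = d
    have hneg : ∀ {x y : PMSet n}, K.1 x y → K.1 (-x) (-y) := fun h => K.2.signed _ _ h
    have tr : ∀ {x y z : PMSet n}, K.1 x y → K.1 y z → K.1 x z := fun h h' => K.1.trans h h'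
    have sy : ∀ {x y : PMSet n}, K.1 x y → K.1 y x := fun h => K.1.symm h
    constructor
    · rintro ⟨⟨⟨h1, h2⟩, h3⟩, h4⟩
      -- Being tied to both a and -a puts b in a zero block; likewise c through d. The two blocks
      -- must coincide.
      have hb : K.1 b (-b) := by
        have := hneg h1
        rw [neg_neg] at this
        exact tr (sy h2) this
      have hc : K.1 c (-c) := tr h3 (sy h4)
      exact ⟨⟨⟨h1, h2⟩, K.2.unique_zero _ _ hb hc⟩, h3⟩
    · rintro ⟨⟨⟨h1, h2⟩, h3⟩, h4⟩
      have hb : K.1 b (-b) := by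
        have := hneg h1
        rw [neg_neg] at this
        exact tr (sy h2) this
      exact ⟨⟨⟨h1, h2⟩, h4⟩, tr (tr (sy (hneg h3)) (sy hb)) (tr h3 h4)⟩
  case td7 i j hij =>
    obtain ⟨a, b, c, hab, hbc, hac, h1, h2, t1, t2, t3, t4, t5, t6⟩ := exists_eps_chain i j hij
    rw [h1, h2]
    simp only [rhoD_sigma_eps, rhoD_sigma_inv_eps, t1, t3, t4, t5]

/-! ### The braid group inside the presented monoid -/

/-- The monoid given by the presentation. -/
abbrev TM (n : ℕ) : Type := PresentedMonoid (TiedRel n)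

/-- The class of the generator `σ_k`. -/
def tmSigma (k : Idx n) : TM n := PresentedMonoid.of _ (.s k)

/-- The class of the generator `σ_k⁻¹`. -/
def tmSigmaInv (k : Idx n) : TM n := PresentedMonoid.of _ (.sInv k)

/-- The class of the generator `θ_k`. -/
def tmTheta (k : Idx n) : TM n := PresentedMonoid.of _ (.th k)

theorem tm_rel {u v : FreeMonoid (Gen n)} (h : TiedRel n u v) :
    PresentedMonoid.mk (TiedRel n) u = PresentedMonoid.mk (TiedRel n) v :=
  PresentedMonoid.mk_eq_mk_of_rel h

/-- `σ_k` as a unit of the presented monoid. -/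
def sigmaUnit (k : Idx n) : (TM n)ˣ :=
  ⟨tmSigma k, tmSigmaInv k, tm_rel (.db0 k), tm_rel (.db0i k)⟩

/-- The homomorphism from the braid group to the units of the presented monoid. -/
def braidUnit (n : ℕ) : BraidD n →* (TM n)ˣ :=
  PresentedGroup.toGroup (f := fun k : Idx n => sigmaUnit k) (by
    rintro w ⟨u, v, h, rfl⟩
    rw [map_mul, map_inv, mul_inv_eq_one]
    cases h <;> simp only [map_mul, FreeGroup.lift_apply_of] <;> apply Units.ext
    case db1 i j hi hj => exact tm_rel (.db1 i j hi hj)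
    case db2 i j hi hj h => exact tm_rel (.db2 i j hi hj h)
    case db3 i j hi hj h => exact tm_rel (.db3 i j hi hj h)
    case db4 i j hi hj h => exact tm_rel (.db4 i j hi hj h))

theorem braidUnit_sigma (k : Idx n) : braidUnit n (sigma k) = sigmaUnit k :=
  PresentedGroup.toGroup.of _

/-- Conjugation by braids on the presented monoid. -/
def conjBraid (n : ℕ) : BraidD n →* ConjAct (TM n)ˣ :=
  (ConjAct.toConjAct : (TM n)ˣ ≃* ConjAct (TM n)ˣ).toMonoidHom.comp (braidUnit n)

theorem conjBraid_smul (w : BraidD n) (x : TM n) :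
    conjBraid n w • x = (braidUnit n w).1 * x * (braidUnit n w)⁻¹.1 := rfl

theorem conjBraid_smul_eq_iff (w : BraidD n) (x y : TM n) :
    conjBraid n w • x = y ↔ (braidUnit n w).1 * x = y * (braidUnit n w).1 := by
  rw [conjBraid_smul, Units.mul_inv_eq_iff_eq_mul]

/-- (TD4), (TD3) and (TD7) read as conjugation identities are `fix`, `swap` and `swap_inv`. -/
theorem tiedAction (n : ℕ) :
    TiedAction (fun k : Idx n => conjBraid n (sigma k)) (fun k : Idx n => tmTheta k) where
  braid i j h := by simp only [← map_mul, sigma_braid i j h]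
  comm i j h := by simp only [← map_mul, sigma_comm i j h]
  fix i j h := by
    rw [conjBraid_smul_eq_iff, braidUnit_sigma]
    exact tm_rel (.td4 i j h)
  swap i j h := by
    rw [smul_smul, ← map_mul, conjBraid_smul_eq_iff, map_mul, braidUnit_sigma, braidUnit_sigma]
    exact (tm_rel (.td3 i j h)).trans (mul_assoc (tmTheta j) (tmSigma i) (tmSigma j))
  swap_inv i j h := by
    rw [smul_smul, ← map_inv, ← map_mul, conjBraid_smul_eq_iff, map_mul, map_inv, braidUnit_sigma,
      braidUnit_sigma]
    exact (tm_rel (.td7 i j h)).trans (mul_assoc (tmTheta j) (tmSigma i) (tmSigmaInv j))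

/-! ### The family of ties -/

/-- The positive root that is `±(e_x - e_y)`. -/
def rootOf (x y : ℤ) : ℤ × ℤ :=
  if |x| < |y| then (if 0 < y then (x, y) else (-x, -y)) else (if 0 < x then (y, x) else (-y, -x))

theorem isPosRoot_rootOf {x y : PMSet n} (h : |x.1| ≠ |y.1|) : IsPosRoot n (rootOf x.1 y.1) := by
  obtain ⟨x, hx, hx'⟩ := x
  obtain ⟨y, hy, hy'⟩ := y
  simp only [rootOf, IsPosRoot] at *
  grind (splits := 20)

theorem rootOf_swap {x y : ℤ} (h : |x| ≠ |y|) : rootOf y x = rootOf x y := by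
  simp only [rootOf] at *
  grind (splits := 20)

theorem rootOf_neg {x y : ℤ} (hx : x ≠ 0) (hy : y ≠ 0) : rootOf (-x) (-y) = rootOf x y := by
  simp only [rootOf, abs_neg] at *
  grind (splits := 20)

theorem rootOf_reflInt (k : Idx n) {x y : ℤ} (hx : x ≠ 0) (hy : y ≠ 0) (h : |x| ≠ |y|) :
    rootOf (reflInt k.1 x) (reflInt k.1 y) = rootRefl k.1 (rootOf x y) := by
  obtain ⟨k, rfl | hk, hn⟩ := k
  · simp only [rootOf, reflInt, rootRefl, abs_neg, abs_one] at *
    grind (splits := 30)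
  · have e : |k| = k := abs_of_nonneg (by omega)
    simp only [rootOf, reflInt, rootRefl, e] at *
    grind (splits := 30)

theorem rootOf_lo_hi (k : Idx n) : rootOf k.lo.1 k.hi.1 = simpleRoot k.1 := by
  have h1 : |k.lo.1| < |k.hi.1| := by
    simp only [Idx.lo, Idx.hi]
    rw [abs_of_nonneg (a := |k.1| + 1) (by positivity)]
    omega
  have h2 : 0 < k.hi.1 := by
    simp only [Idx.hi]
    positivity
  rw [rootOf, if_pos h1, if_pos h2]
  rfl

theorem abs_eq_abs_iff {a b : PMSet n} : |a.1| = |b.1| ↔ a = b ∨ a = -b := by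
  rw [abs_eq_abs, Subtype.ext_iff, Subtype.ext_iff, coe_neg]

theorem ne_neg_of_abs_ne {a b : PMSet n} (h : |a.1| ≠ |b.1|) : a ≠ -b :=
  fun e => h (abs_eq_abs_iff.mpr (Or.inr e))

theorem abs_perm_ne {t : Equiv.Perm (PMSet n)} (ht : t ∈ signedPerm n) {a b : PMSet n}
    (h : |a.1| ≠ |b.1|) : |(t a).1| ≠ |(t b).1| := by
  rw [ne_eq, abs_eq_abs_iff] at *
  rw [← ht, t.injective.eq_iff, t.injective.eq_iff]
  exact h

/-- A family of elements of the presented monoid that behaves like the `ε_{a,b}` under conjugation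
by braids, and extends the `θ_k`. -/
structure IsTieFamily (E : PMSet n → PMSet n → TM n) : Prop where
  idx : ∀ k : Idx n, E k.lo k.hi = tmTheta k
  swap : ∀ a b : PMSet n, |a.1| ≠ |b.1| → E b a = E a b
  neg : ∀ a b : PMSet n, E (-a) (-b) = E a b
  conj : ∀ (w : BraidD n) (a b : PMSet n), |a.1| ≠ |b.1| →
    conjBraid n w • E a b = E ((piD n w).1 a) ((piD n w).1 b)

theorem exists_isTieFamily (n : ℕ) : ∃ E : PMSet n → PMSet n → TM n, IsTieFamily E := by
  obtain ⟨F, h1, h2⟩ := (tiedAction n).exists_family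
  refine ⟨fun a b => F (rootOf a.1 b.1), fun k => ?_, fun a b h => ?_, fun a b => ?_, ?_⟩
  · simp only [rootOf_lo_hi, h1]
  · simp only [rootOf_swap h]
  · simp only [coe_neg, rootOf_neg a.2.1 b.2.1]
  -- The braids satisfying equivariance form a subgroup, so the generators suffice.
  · let H : Subgroup (BraidD n) :=
      { carrier := {w | ∀ a b : PMSet n, |a.1| ≠ |b.1| → conjBraid n w • F (rootOf a.1 b.1) =
          F (rootOf ((piD n w).1 a).1 ((piD n w).1 b).1)}
        one_mem' := fun a b _ => by
          rw [map_one, map_one, one_smul]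
          rfl
        mul_mem' := by
          intro v w hv hw a b h
          rw [map_mul, mul_smul, hw a b h, hv _ _ (abs_perm_ne (piD n w).2.1 h), map_mul]
          rfl
        inv_mem' := by
          intro w hw a b h
          have h3 := hw _ _ (abs_perm_ne (piD n w⁻¹).2.1 h)
          have e : ∀ x, (piD n w).1 ((piD n w⁻¹).1 x) = x := fun x => by
            rw [map_inv]
            exact (piD n w).1.apply_symm_apply x
          rw [e, e] at h3
          rw [← h3, map_inv, inv_smul_smul] }
    intro w
    refine PresentedGroup.generated_by _ H (fun k a b h => ?_) w
    change conjBraid n (sigma k) • _ = F (rootOf ((piD n (sigma k)).1 a).1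
      ((piD n (sigma k)).1 b).1)
    rw [h2 k _ (isPosRoot_rootOf h), piD_sigma, coe_tGen_eq_reflInt, coe_tGen_eq_reflInt,
      rootOf_reflInt k a.2.1 b.2.1 h]

/-! ### Moving configurations by braids -/

theorem piD_mul_apply (v w : BraidD n) (x : PMSet n) :
    (piD n (v * w)).1 x = (piD n v).1 ((piD n w).1 x) := by
  rw [map_mul]
  rfl

/-- Every reflection is conjugate to a simple one: conjugating by a lowering simple reflection
reduces the height. -/
theorem exists_piD_eq_of_isPosRoot {β : ℤ × ℤ} (hβ : IsPosRoot n β) (a b : PMSet n) (ha : a.1 = β.1)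
    (hb : b.1 = β.2) : ∃ w : BraidD n, (piD n w).1 = signedTransp a b := by
  induction h : (rootHeight β).toNat using Nat.strong_induction_on generalizing β a b with
  | _ N ih =>
    by_cases h0 : ∃ k : Idx n, β = simpleRoot k.1
    · obtain ⟨k, rfl⟩ := h0
      obtain rfl : a = k.lo := Subtype.ext ha
      obtain rfl : b = k.hi := Subtype.ext hb
      exact ⟨sigma k, by rw [piD_sigma]; rfl⟩
    · push Not at h0
      obtain ⟨k, hk⟩ := exists_rootPair_eq_one hβ h0
      have hr := isPosRoot_rootRefl hβ k
      have h1 := rootHeight_lower hβ hk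
      have h2 := rootHeight_pos hr
      have h3 := rootRefl_of_rootPair_eq_one hk
      obtain ⟨w, hw⟩ := ih _ (by omega) hr ((tGen k).1 a) ((tGen k).1 b)
        (by rw [coe_tGen_eq_reflInt, h3, ha]) (by rw [coe_tGen_eq_reflInt, h3, hb]) rfl
      refine ⟨sigma k * w * sigma k, ?_⟩
      have e : (tGen k).1 * (tGen k).1 = 1 := congrArg Subtype.val (tGen_mul_self k)
      have e' : ∀ x, (tGen k).1 ((tGen k).1 x) = x := fun x => congrArg (fun f => f x) e
      rw [map_mul, map_mul, piD_sigma]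
      change (tGen k).1 * (piD n w).1 * (tGen k).1 = _
      rw [hw, mul_signedTransp (tGen k).2.1, e', e', mul_assoc, e, mul_one]

theorem exists_piD_eq_signedTransp {a b : PMSet n} (h : |a.1| ≠ |b.1|) :
    ∃ w : BraidD n, (piD n w).1 = signedTransp a b := by
  have hr := isPosRoot_rootOf h
  have hab := ne_neg_of_abs_ne h
  unfold rootOf at hr
  split_ifs at hr
  · exact exists_piD_eq_of_isPosRoot hr a b rfl rfl
  · rw [← signedTransp_neg hab]
    exact exists_piD_eq_of_isPosRoot hr (-a) (-b) rfl rfl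
  · rw [signedTransp_comm]
    exact exists_piD_eq_of_isPosRoot hr b a rfl rfl
  · rw [← signedTransp_neg hab, signedTransp_comm]
    exact exists_piD_eq_of_isPosRoot hr (-b) (-a) rfl rfl

theorem signedTransp_left {a b : PMSet n} (h : |a.1| ≠ |b.1|) : signedTransp a b a = b := by
  rw [signedTransp_apply (ne_neg_of_abs_ne h), if_pos rfl]

theorem signedTransp_of_abs_ne {a b x : PMSet n} (h : |a.1| ≠ |b.1|) (ha : |x.1| ≠ |a.1|)
    (hb : |x.1| ≠ |b.1|) : signedTransp a b x = x := by
  rw [ne_eq, abs_eq_abs_iff, not_or] at ha hb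
  rw [signedTransp_apply (ne_neg_of_abs_ne h), if_neg ha.1, if_neg hb.1, if_neg ha.2, if_neg hb.2]

/-- Some braid moves `a` to `m ≥ 2`, and fixes all `x` with `|x| ∉ {1, |a|, m}`. -/
theorem exists_move (a m : PMSet n) (hm : 2 ≤ m.1) : ∃ w : BraidD n, (piD n w).1 a = m ∧
    ∀ x : PMSet n, |x.1| ≠ 1 → |x.1| ≠ |a.1| → |x.1| ≠ |m.1| → (piD n w).1 x = x := by
  by_cases h : |a.1| = |m.1|
  · rcases abs_eq_abs_iff.mp h with rfl | rfl
    · exact ⟨1, by rw [map_one]; rfl, fun x _ _ _ => by rw [map_one]; rfl⟩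
    · have hn : (1 : ℤ) ≤ n := by have := m.2.2; rw [abs_of_nonneg (by omega)] at this; omega
      -- An even-signed permutation cannot change the sign of m alone; the detour -m ↦ 1 ↦ m also
      -- changes the sign of 1.
      let o : PMSet n := ⟨1, by simp, by simpa using hn⟩
      have ho : |o.1| = 1 := abs_one
      have hm1 : |m.1| ≠ 1 := by rw [abs_of_nonneg (by omega)]; omega
      have h1 : |(-m : PMSet n).1| ≠ |o.1| := by rwa [ho, coe_neg, abs_neg]
      have h2 : |o.1| ≠ |m.1| := by rw [ho]; exact hm1.symm
      obtain ⟨v, hv⟩ := exists_piD_eq_signedTransp h1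
      obtain ⟨w, hw⟩ := exists_piD_eq_signedTransp h2
      refine ⟨w * v, ?_, fun x hx1 _ hxm => ?_⟩
      · rw [piD_mul_apply, hv, signedTransp_left h1, hw, signedTransp_left h2]
      · rw [piD_mul_apply, hv, signedTransp_of_abs_ne h1 (by rwa [coe_neg, abs_neg]) (by rwa [ho]),
          hw, signedTransp_of_abs_ne h2 (by rwa [ho]) hxm]
  · obtain ⟨w, hw⟩ := exists_piD_eq_signedTransp h
    exact ⟨w, by rw [hw, signedTransp_left h],
      fun x _ hxa hxm => by rw [hw, signedTransp_of_abs_ne h hxa hxm]⟩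

/-- Some braid moves `a` to `±1`, and fixes all `x` with `|x| ∉ {1, |a|}`. -/
theorem exists_move_one (a : PMSet n) : ∃ w : BraidD n, |((piD n w).1 a).1| = 1 ∧
    ∀ x : PMSet n, |x.1| ≠ 1 → |x.1| ≠ |a.1| → (piD n w).1 x = x := by
  by_cases h : |a.1| = 1
  · exact ⟨1, by rw [map_one]; exact h, fun x _ _ => by rw [map_one]; rfl⟩
  · have hn : (1 : ℤ) ≤ n := by
      have := a.2.2
      have := abs_pos.mpr a.2.1
      omega
    let o : PMSet n := ⟨1, by simp, by simpa using hn⟩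
    have ho : |o.1| = 1 := abs_one
    have h1 : |a.1| ≠ |o.1| := by rwa [ho]
    obtain ⟨w, hw⟩ := exists_piD_eq_signedTransp h1
    exact ⟨w, by rw [hw, signedTransp_left h1, ho],
      fun x hx hxa => by rw [hw, signedTransp_of_abs_ne h1 hxa (by rwa [ho])]⟩

/-- The larger target is reached first, so that the later move leaves it in place. The last element
is placed only up to sign, since sign changes come in even number; this is harmless because both 1
and -1 are indices. -/
theorem exists_move_two {a b : PMSet n} (hab : |a.1| ≠ |b.1|) : ∃ w : BraidD n,
    |((piD n w).1 a).1| = 1 ∧ ((piD n w).1 b).1 = 2 ∧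
    ∀ x : PMSet n, 2 < x.1 → |x.1| ≠ |a.1| → |x.1| ≠ |b.1| → (piD n w).1 x = x := by
  have ha := abs_pos.mpr a.2.1
  have hb := abs_pos.mpr b.2.1
  have hn : (2 : ℤ) ≤ n := by have := a.2.2; have := b.2.2; omega
  obtain ⟨v, hv, hv'⟩ := exists_move b ⟨2, by simp, by simpa using hn⟩ le_rfl
  obtain ⟨w, hw, hw'⟩ := exists_move_one ((piD n v).1 a)
  have h1 := abs_perm_ne (piD n v).2.1 hab
  rw [hv] at h1
  have e2 : ∀ x : PMSet n, 2 < x.1 → |x.1| = x.1 := fun x hx => abs_of_pos (by omega)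
  refine ⟨w * v, ?_, ?_, fun x hx hxa hxb => ?_⟩
  · rwa [piD_mul_apply]
  · rw [piD_mul_apply, hv, hw']
    · simp
    · exact h1.symm
  · have h2 := hv' x (by rw [e2 x hx]; omega) hxb (by rw [e2 x hx]; simp; omega)
    have h3 := abs_perm_ne (piD n v).2.1 hxa
    rw [h2] at h3
    rw [piD_mul_apply, h2, hw' x (by rw [e2 x hx]; omega) h3]

theorem exists_move_three {a b c : PMSet n} (hab : |a.1| ≠ |b.1|) (hac : |a.1| ≠ |c.1|)
    (hbc : |b.1| ≠ |c.1|) : ∃ w : BraidD n,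
    |((piD n w).1 a).1| = 1 ∧ ((piD n w).1 b).1 = 2 ∧ ((piD n w).1 c).1 = 3 ∧
    ∀ x : PMSet n, 3 < x.1 → |x.1| ≠ |a.1| → |x.1| ≠ |b.1| → |x.1| ≠ |c.1| →
      (piD n w).1 x = x := by
  have ha := abs_pos.mpr a.2.1
  have hb := abs_pos.mpr b.2.1
  have hc := abs_pos.mpr c.2.1
  have hn : (3 : ℤ) ≤ n := by have := a.2.2; have := b.2.2; have := c.2.2; omega
  obtain ⟨v, hv, hv'⟩ := exists_move c ⟨3, by simp, by simpa using hn⟩ (by simp)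
  have h1 := abs_perm_ne (piD n v).2.1 hab
  have h2 := abs_perm_ne (piD n v).2.1 hac
  have h3 := abs_perm_ne (piD n v).2.1 hbc
  obtain ⟨w, hw1, hw2, hw⟩ := exists_move_two h1
  rw [hv] at h2 h3
  have e2 : ∀ x : PMSet n, 3 < x.1 → |x.1| = x.1 := fun x hx => abs_of_pos (by omega)
  refine ⟨w * v, ?_, ?_, ?_, fun x hx hxa hxb hxc => ?_⟩
  · rwa [piD_mul_apply]
  · rwa [piD_mul_apply]
  · rw [piD_mul_apply, hv, hw _ (by simp) h2.symm h3.symm]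
  · have h4 := hv' x (by rw [e2 x hx]; omega) hxc (by rw [e2 x hx]; simp; omega)
    have h5 := abs_perm_ne (piD n v).2.1 hxa
    have h6 := abs_perm_ne (piD n v).2.1 hxb
    rw [h4] at h5 h6
    rw [piD_mul_apply, h4, hw x (by omega) h5 h6]

theorem exists_move_four {a b c d : PMSet n} (hab : |a.1| ≠ |b.1|) (hac : |a.1| ≠ |c.1|)
    (hbc : |b.1| ≠ |c.1|) (had : |a.1| ≠ |d.1|) (hbd : |b.1| ≠ |d.1|) (hcd : |c.1| ≠ |d.1|) :
    ∃ w : BraidD n, |((piD n w).1 a).1| = 1 ∧ ((piD n w).1 b).1 = 2 ∧ ((piD n w).1 c).1 = 3 ∧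
      ((piD n w).1 d).1 = 4 := by
  have ha := abs_pos.mpr a.2.1
  have hb := abs_pos.mpr b.2.1
  have hc := abs_pos.mpr c.2.1
  have hd := abs_pos.mpr d.2.1
  have hn : (4 : ℤ) ≤ n := by
    have := a.2.2; have := b.2.2; have := c.2.2; have := d.2.2; omega
  obtain ⟨v, hv, hv'⟩ := exists_move d ⟨4, by simp, by simpa using hn⟩ (by simp)
  have h1 := abs_perm_ne (piD n v).2.1 had
  have h2 := abs_perm_ne (piD n v).2.1 hbd
  have h3 := abs_perm_ne (piD n v).2.1 hcd
  obtain ⟨w, hw1, hw2, hw3, hw⟩ := exists_move_three (abs_perm_ne (piD n v).2.1 hab)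
    (abs_perm_ne (piD n v).2.1 hac) (abs_perm_ne (piD n v).2.1 hbc)
  rw [hv] at h1 h2 h3
  refine ⟨w * v, ?_, ?_, ?_, ?_⟩
  · rwa [piD_mul_apply]
  · rwa [piD_mul_apply]
  · rwa [piD_mul_apply]
  · rw [piD_mul_apply, hv, hw _ (by simp) h1.symm h2.symm h3.symm]

/-! ### Relations between ties -/

namespace IsTieFamily

variable {E : PMSet n → PMSet n → TM n} (hE : IsTieFamily E)
include hE

theorem eq_theta (k : Idx n) {a b : PMSet n} (ha : a.1 = k.1) (hb : b.1 = |k.1| + 1) :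
    E a b = tmTheta k := by
  obtain rfl : a = k.lo := Subtype.ext ha
  obtain rfl : b = k.hi := Subtype.ext hb
  exact hE.idx k

theorem neg_left (a b : PMSet n) : E (-a) b = E a (-b) := by
  rw [← hE.neg a (-b), neg_neg]

theorem exists_eq_theta {a b : PMSet n} (h : |a.1| ≠ |b.1|) :
    ∃ (w : BraidD n) (k : Idx n), (piD n w).1 a = k.lo ∧ (piD n w).1 b = k.hi ∧
      conjBraid n w • E a b = tmTheta k := by
  obtain ⟨w, h1, h2⟩ := exists_move_two h
  have hn : (2 : ℤ) ≤ n := by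
    have := ((piD n w).1 b).2.2
    rw [h2.1] at this
    simpa using this
  obtain ⟨k, hk⟩ : ∃ k : Idx n, ((piD n w).1 a).1 = k.1 := by
    refine ⟨⟨((piD n w).1 a).1, ?_, by rw [h1]; omega⟩, rfl⟩
    rcases (abs_eq zero_le_one).mp h1 with h | h <;> omega
  refine ⟨w, k, Subtype.ext hk, Subtype.ext ?_, ?_⟩
  · change _ = |k.1| + 1
    rw [h2.1, ← hk, h1]; rfl
  · rw [hE.conj w a b h]
    exact hE.eq_theta k hk (by rw [h2.1, ← hk, h1]; rfl)

theorem mul_self {a b : PMSet n} (h : |a.1| ≠ |b.1|) : E a b * E a b = E a b := by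
  obtain ⟨w, k, -, -, hk⟩ := hE.exists_eq_theta h
  apply smul_left_cancel (conjBraid n w)
  rw [smul_mul', hk]
  exact tm_rel (.td1 k)

theorem comm_of_conj {a b c d : PMSet n} (hab : |a.1| ≠ |b.1|) (hcd : |c.1| ≠ |d.1|)
    (w : BraidD n) (i j : Idx n) (ha : ((piD n w).1 a).1 = i.1) (hb : ((piD n w).1 b).1 = |i.1| + 1)
    (hc : ((piD n w).1 c).1 = j.1) (hd : ((piD n w).1 d).1 = |j.1| + 1) :
    Commute (E a b) (E c d) := by
  apply smul_left_cancel (conjBraid n w)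
  rw [smul_mul', smul_mul', hE.conj w a b hab, hE.conj w c d hcd, hE.eq_theta i ha hb,
    hE.eq_theta j hc hd]
  exact tm_rel (.td2 i j)

theorem comm_of_left_eq {a b c : PMSet n} (hab : |a.1| ≠ |b.1|) (hac : |a.1| ≠ |c.1|) :
    Commute (E a b) (E a c) := by
  have idx : ∀ x : PMSet n, |x.1| = 1 → (2 : ℤ) ≤ n → ∃ k : Idx n, x.1 = k.1 ∧ |k.1| = 1 := by
    intro x hx hn
    refine ⟨⟨x.1, ?_, by rw [hx]; omega⟩, rfl, hx⟩
    rcases (abs_eq zero_le_one).mp hx with h | h <;> omega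
  by_cases hbc : |b.1| = |c.1|
  · rcases abs_eq_abs_iff.mp hbc with rfl | rfl
    · exact Commute.refl _
    -- The ties of a with c and -c become θ₁ and θ₋₁ in some order.
    · obtain ⟨w, h1, h2, -⟩ := exists_move_two (a := c) (b := a) (Ne.symm hac)
      have hn : (2 : ℤ) ≤ n := by
        have := ((piD n w).1 a).2.2
        rw [h2] at this
        simpa using this
      have h3 : ((piD n w).1 (-c)).1 = -((piD n w).1 c).1 := by rw [(piD n w).2.1]; rfl
      obtain ⟨i, hi, hi'⟩ := idx _ h1 hn
      obtain ⟨j, hj, hj'⟩ := idx ((piD n w).1 (-c)) (by rw [h3, abs_neg, h1]) hn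
      rw [← hE.swap _ _ hac, ← hE.swap _ _ hab]
      exact hE.comm_of_conj hab.symm hac.symm w j i hj (by rw [hj', h2]; rfl) hi
        (by rw [hi', h2]; rfl)
  · obtain ⟨w, h1, h2, h3, -⟩ := exists_move_three hab.symm hbc hac
    have hn : (3 : ℤ) ≤ n := by
      have := ((piD n w).1 c).2.2
      rw [h3] at this
      simpa using this
    obtain ⟨i, hi, hi'⟩ := idx _ h1 (by omega)
    rw [← hE.swap _ _ hab]
    exact hE.comm_of_conj hab.symm hac w i ⟨2, by simp, by simp; omega⟩ hi (by rw [hi', h2]; rfl)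
      h2 h3

theorem comm {a b c d : PMSet n} (hab : |a.1| ≠ |b.1|) (hcd : |c.1| ≠ |d.1|) :
    Commute (E a b) (E c d) := by
  have left : ∀ {a b c d : PMSet n}, |a.1| ≠ |b.1| → |c.1| ≠ |d.1| → |a.1| = |c.1| →
      Commute (E a b) (E c d) := by
    intro a b c d hab hcd hac
    rcases abs_eq_abs_iff.mp hac with rfl | rfl
    · exact hE.comm_of_left_eq hab hcd
    · rw [hE.neg_left]
      exact hE.comm_of_left_eq (by rwa [coe_neg, abs_neg] at *) hcd
  by_cases hac : |a.1| = |c.1|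
  · exact left hab hcd hac
  by_cases had : |a.1| = |d.1|
  · rw [← hE.swap c d hcd]
    exact left hab hcd.symm had
  by_cases hbc : |b.1| = |c.1|
  · rw [← hE.swap a b hab]
    exact left hab.symm hcd hbc
  by_cases hbd : |b.1| = |d.1|
  · rw [← hE.swap a b hab, ← hE.swap c d hcd]
    exact left hab.symm hcd.symm hbd
  -- With four distinct absolute values the ties become θ_{±1} and θ₃.
  obtain ⟨w, h1, h2, h3, h4⟩ := exists_move_four hab hac hbc had hbd hcd
  have hn : (4 : ℤ) ≤ n := by
    have := ((piD n w).1 d).2.2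
    rw [h4] at this
    simpa using this
  exact hE.comm_of_conj hab hcd w ⟨((piD n w).1 a).1,
    by rcases (abs_eq zero_le_one).mp h1 with h | h <;> omega, by omega⟩
    ⟨3, by simp, by simp; omega⟩ rfl (by simp only [h1, h2]; rfl) h3 h4

/-- Ties are transitive. -/
theorem mul_eq_mul {a b c : PMSet n} (hab : |a.1| ≠ |b.1|) (hbc : |b.1| ≠ |c.1|)
    (hac : |a.1| ≠ |c.1|) : E a c * E b c = E a b * E b c := by
  obtain ⟨w, h1, h2, h3, -⟩ := exists_move_three hab hac hbc
  have hn : (3 : ℤ) ≤ n := by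
    have := ((piD n w).1 c).2.2
    rw [h3] at this
    simpa using this
  rw [(hE.comm hac hbc).eq]
  apply smul_left_cancel (conjBraid n w)
  rw [smul_mul', smul_mul', hE.conj w a b hab, hE.conj w b c hbc, hE.conj w a c hac]
  have hab' := abs_perm_ne (piD n w).2.1 hab
  have hbc' := abs_perm_ne (piD n w).2.1 hbc
  generalize (piD n w).1 a = a at *
  generalize (piD n w).1 b = b at *
  generalize (piD n w).1 c = c at *
  have ha : a.1 = -1 ∨ 1 ≤ a.1 := by rcases (abs_eq zero_le_one).mp h1 with h | h <;> omega
  let i : Idx n := ⟨a.1, ha, by omega⟩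
  let j : Idx n := ⟨2, by simp, by simp; omega⟩
  have hij : AdjD i.1 j.1 := by
    simp only [AdjD, i, j, h1]
    rfl
  have e1 := hE.eq_theta i (a := a) (b := b) rfl (by rw [h2]; simp only [i, h1]; rfl)
  have e2 := hE.eq_theta j (a := b) (b := c) h2 h3
  -- Writing the third tie as a conjugate turns the claim into the relation θ_j σ_i θ_j = θ_i θ_j
  -- σ_i of (TD5).
  have e3 : E a c = conjBraid n (sigma i) • E b c := by
    rw [hE.conj _ _ _ hbc', piD_sigma]
    congr 1 <;> apply Subtype.ext <;> rw [coe_tGen_eq_reflInt]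
    · simp only [reflInt, i, h1, h2]; grind
    · simp only [reflInt, i, h1, h3]; grind
  rw [e3, e1, e2, conjBraid_smul, braidUnit_sigma, ← mul_assoc, Units.mul_inv_eq_iff_eq_mul,
    ← mul_assoc]
  exact (tm_rel (.td5 i j hij)).symm

theorem trans_absorb {a b c : PMSet n} (hab : |a.1| ≠ |b.1|) (hbc : |b.1| ≠ |c.1|)
    (hac : |a.1| ≠ |c.1|) {x : TM n} (h1 : E a b * x = x) (h2 : E b c * x = x) :
    E a c * x = x := by
  rw [← h2, ← mul_assoc, hE.mul_eq_mul hab hbc hac, mul_assoc, h2, h1]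

/-- Two zero blocks are joined. -/
theorem zero_absorb {a b c d : PMSet n} (hab : |a.1| ≠ |b.1|) (hac : |a.1| ≠ |c.1|)
    (hbc : |b.1| ≠ |c.1|) (had : |a.1| ≠ |d.1|) (hbd : |b.1| ≠ |d.1|) (hcd : |c.1| ≠ |d.1|)
    {x : TM n} (h1 : E a b * x = x) (h2 : E (-a) b * x = x) (h3 : E c d * x = x)
    (h4 : E (-c) d * x = x) : E b c * x = x := by
  have neg_ne : ∀ {x y : PMSet n}, |x.1| ≠ |y.1| → |(-x : PMSet n).1| ≠ |y.1| := by
    intro x y h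
    rwa [coe_neg, abs_neg]
  obtain ⟨w, k1, k2, k3, k4⟩ := exists_move_four hab hac hbc had hbd hcd
  apply smul_left_cancel (conjBraid n w)
  have key : ∀ {a b : PMSet n}, |a.1| ≠ |b.1| → conjBraid n w • (E a b * x) =
      E ((piD n w).1 a) ((piD n w).1 b) * conjBraid n w • x := fun h => by
    rw [smul_mul', hE.conj w _ _ h]
  replace h1 := (key hab).symm.trans (congrArg (conjBraid n w • ·) h1)
  replace h2 := (key (neg_ne hab)).symm.trans (congrArg (conjBraid n w • ·) h2)
  replace h3 := (key hcd).symm.trans (congrArg (conjBraid n w • ·) h3)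
  replace h4 := (key (neg_ne hcd)).symm.trans (congrArg (conjBraid n w • ·) h4)
  rw [key hbc]
  rw [(piD n w).2.1] at h2 h4
  have hcd' := abs_perm_ne (piD n w).2.1 hcd
  have hbc' := abs_perm_ne (piD n w).2.1 hbc
  generalize (piD n w).1 a = a at *
  generalize (piD n w).1 b = b at *
  generalize (piD n w).1 c = c at *
  generalize (piD n w).1 d = d at *
  generalize conjBraid n w • x = x at *
  have hn : (4 : ℤ) ≤ n := by
    have := d.2.2
    rw [k4] at this
    simpa using this
  let m : Idx n := ⟨-1, by simp, by simp; omega⟩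
  let i : Idx n := ⟨1, by simp, by simp; omega⟩
  let j : Idx n := ⟨2, by simp, by simp; omega⟩
  let k : Idx n := ⟨3, by simp, by simp; omega⟩
  -- Whichever sign the move gave to a, the ties of a and -a with b are θ₁ and θ₋₁.
  have em : tmTheta m * x = x := by
    rcases (abs_eq zero_le_one).mp k1 with h | h
    · rwa [hE.eq_theta m (a := -a) (b := b) (by rw [coe_neg, h]) (by rw [k2]; rfl)] at h2
    · rwa [hE.eq_theta m (a := a) (b := b) h (by rw [k2]; rfl)] at h1
  have ei : tmTheta i * x = x := by
    rcases (abs_eq zero_le_one).mp k1 with h | h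
    · rwa [hE.eq_theta i (a := a) (b := b) h (by rw [k2]; rfl)] at h1
    · rwa [hE.eq_theta i (a := -a) (b := b) (by rw [coe_neg, h]; rfl) (by rw [k2]; rfl)] at h2
  have ek : E c d = tmTheta k := hE.eq_theta k k3 k4
  have ej : E b c = tmTheta j := hE.eq_theta j k2 k3
  have e4 : E (-c) d = conjBraid n (sigma j * sigma m * sigma i * sigma j) • E c d := by
    rw [hE.conj _ _ _ hcd']
    simp only [map_mul, piD_sigma]
    congr 1 <;> apply Subtype.ext
    · change _ = ((tGen j).1 ((tGen m).1 ((tGen i).1 ((tGen j).1 c)))).1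
      simp only [coe_tGen_eq_reflInt, coe_neg, k3, m, i, j]
      decide
    · change _ = ((tGen j).1 ((tGen m).1 ((tGen i).1 ((tGen j).1 d)))).1
      simp only [coe_tGen_eq_reflInt, k4, m, i, j]
      decide
  rw [ej]
  have r6 : tmTheta m * tmTheta i * tmTheta k * tmSigma j * tmSigma m * tmSigma i * tmSigma j *
      tmTheta k = tmTheta m * tmTheta i * tmTheta j * tmTheta k * tmSigma j * tmSigma m *
        tmSigma i * tmSigma j := tm_rel (.td6 m i j k rfl rfl rfl rfl)
  have r7 : tmTheta m * tmTheta i * tmTheta k * E (-c) d =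
      tmTheta m * tmTheta i * tmTheta j * tmTheta k := by
    rw [e4, conjBraid_smul, ← mul_assoc, Units.mul_inv_eq_iff_eq_mul, ek]
    simp only [map_mul, braidUnit_sigma]
    change tmTheta m * tmTheta i * tmTheta k * (tmSigma j * tmSigma m * tmSigma i * tmSigma j *
      tmTheta k) = tmTheta m * tmTheta i * tmTheta j * tmTheta k *
        (tmSigma j * tmSigma m * tmSigma i * tmSigma j)
    simpa only [mul_assoc] using r6
  have cij : tmTheta i * tmTheta j = tmTheta j * tmTheta i := tm_rel (.td2 i j)
  have cmj : tmTheta m * tmTheta j = tmTheta j * tmTheta m := tm_rel (.td2 m j)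
  rw [ek] at h3
  -- Applied to x, the left side of `r7` collapses to x, since all its factors are absorbed; on the
  -- right only θ₂ remains once θ₁ and θ₋₁ have passed it.
  have r8 := congrArg (· * x) r7
  simp only [mul_assoc, h4, h3] at r8
  rw [ei, em, ← mul_assoc (tmTheta i), cij, mul_assoc, ei, ← mul_assoc, cmj, mul_assoc, em] at r8
  exact r8.symm

end IsTieFamily

/-! ### From partitions to ties -/

/-- Otherwise the zero block would be {a, -a}, which has only two elements. -/
theorem IsDPartition.exists_of_zero {r : Setoid (PMSet n)} (hr : IsDPartition r) {a : PMSet n}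
    (h : r a (-a)) : ∃ c : PMSet n, |a.1| ≠ |c.1| ∧ r a c := by
  by_contra hcon
  push Not at hcon
  have hsub : {y | r a y} ⊆ {a, -a} := by
    intro y hy
    by_contra hn
    refine hcon y (fun e => hn ?_) hy
    rcases abs_eq_abs_iff.mp e with rfl | rfl
    · exact Or.inl rfl
    · exact Or.inr (by simp)
  have h1 := (Set.ncard_le_ncard hsub (Set.toFinite _)).trans (Set.ncard_insert_le _ _)
  rw [Set.ncard_singleton] at h1
  have h2 := hr.positive a h
  omega

/-- A `D_n`-partition is determined by its pairs `a, b` with `a ≠ ±b`. -/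
theorem IsDPartition.le_of_forall {r s : Setoid (PMSet n)} (hr : IsDPartition r)
    (h : ∀ a b : PMSet n, |a.1| ≠ |b.1| → r a b → s a b) : r ≤ s := by
  intro a b hab
  by_cases he : |a.1| = |b.1|
  · rcases abs_eq_abs_iff.mp he with rfl | rfl
    · exact s.refl _
    · have hb := r.symm hab
      obtain ⟨c, hc, hbc⟩ := hr.exists_of_zero hb
      have h1 := h b c hc hbc
      have h2 := h (-b) c (by rwa [coe_neg, abs_neg]) (r.trans hab hbc)
      exact s.trans h2 (s.symm h1)
  · exact h a b he hab

namespace IsTieFamily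

variable {E : PMSet n → PMSet n → TM n} (hE : IsTieFamily E)
include hE

/-- The partition formed by the ties that `x` absorbs. -/
theorem exists_absorbed (x : TM n) :
    ∃ I : PD n, ∀ a b : PMSet n, |a.1| ≠ |b.1| → (I.1 a b ↔ E a b * x = x) := by
  let A : PMSet n → PMSet n → Prop := fun a b => |a.1| ≠ |b.1| ∧ E a b * x = x
  -- There is no tie between a and -a, so membership in the zero block is detected through a common
  -- neighbour.
  let Z : PMSet n → Prop := fun a => ∃ c, A a c ∧ A (-a) c
  have neg_abs : ∀ a : PMSet n, |(-a : PMSet n).1| = |a.1| := fun a => by rw [coe_neg, abs_neg]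
  have Asymm : ∀ {a b}, A a b → A b a := fun {a b} h => ⟨h.1.symm, by rw [hE.swap a b h.1, h.2]⟩
  have Aneg : ∀ {a b}, A a b → A (-a) (-b) := fun {a b} h =>
    ⟨by rw [neg_abs, neg_abs]; exact h.1, by rw [hE.neg, h.2]⟩
  have Aneg' : ∀ {a b}, A (-a) b → A a (-b) := fun {a b} h => by simpa using Aneg h
  have Atrans : ∀ {a b c}, |a.1| ≠ |c.1| → A a b → A b c → A a c := fun {a b c} h h1 h2 =>
    ⟨h, hE.trans_absorb h1.1 h2.1 h h1.2 h2.2⟩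
  have Zneg : ∀ {a}, Z a → Z (-a) := by
    rintro a ⟨c, h1, h2⟩
    exact ⟨c, h2, by rwa [neg_neg]⟩
  have AZ : ∀ {a b}, A a b → Z b → A a (-b) := by
    rintro a b h ⟨d, h1, h2⟩
    have hab : |a.1| ≠ |(-b : PMSet n).1| := by rw [neg_abs]; exact h.1
    by_cases had : |a.1| = |d.1|
    · rcases abs_eq_abs_iff.mp had with rfl | rfl
      · exact Asymm h2
      · exact Asymm (Aneg h1)
    · exact Atrans hab (Atrans had h h1) (Asymm h2)
  have ZZ : ∀ {a b}, |a.1| ≠ |b.1| → Z a → Z b → A a b := by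
    rintro a b hab ⟨c, h1, h2⟩ ⟨d, h3, h4⟩
    by_cases hcb : |c.1| = |b.1|
    · rcases abs_eq_abs_iff.mp hcb with rfl | rfl
      · exact h1
      · simpa using Aneg h2
    by_cases hda : |d.1| = |a.1|
    · rcases abs_eq_abs_iff.mp hda with rfl | rfl
      · exact Asymm h3
      · have := Aneg h4
        simp only [neg_neg] at this
        exact Asymm this
    by_cases hcd : |c.1| = |d.1|
    · rcases abs_eq_abs_iff.mp hcd with rfl | rfl
      · exact Atrans hab h1 (Asymm h3)
      · exact Atrans hab h1 (Asymm (Aneg' h4))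
    -- Overlapping configurations follow from symmetry and transitivity; (TD6) is needed when a, b,
    -- c, d have distinct absolute values.
    have h5 : E c b * x = x := hE.zero_absorb h1.1 hab hcb (Ne.symm hda) hcd h3.1 h1.2 h2.2 h3.2 h4.2
    exact Atrans hab h1 ⟨hcb, h5⟩
  let r : Setoid (PMSet n) :=
    { r := fun a b => a = b ∨ A a b ∨ (a = -b ∧ Z b)
      iseqv := by
        refine ⟨fun a => Or.inl rfl, ?_, ?_⟩
        · rintro a b (rfl | h | ⟨rfl, h⟩)
          · exact Or.inl rfl
          · exact Or.inr (Or.inl (Asymm h))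
          · exact Or.inr (Or.inr ⟨(neg_neg b).symm, Zneg h⟩)
        · rintro a b c (rfl | h | ⟨rfl, h⟩) (rfl | h' | ⟨rfl, h'⟩)
          · exact Or.inl rfl
          · exact Or.inr (Or.inl h')
          · exact Or.inr (Or.inr ⟨rfl, h'⟩)
          · exact Or.inr (Or.inl h)
          · by_cases hac : |a.1| = |c.1|
            · rcases abs_eq_abs_iff.mp hac with rfl | rfl
              · exact Or.inl rfl
              · exact Or.inr (Or.inr ⟨rfl, b, Asymm h', h⟩)
            · exact Or.inr (Or.inl (Atrans hac h h'))
          · refine Or.inr (Or.inl ?_)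
            simpa using AZ h (Zneg h')
          · exact Or.inr (Or.inr ⟨rfl, h⟩)
          · exact Or.inr (Or.inl (Asymm (AZ (Asymm h') h)))
          · exact Or.inl (neg_neg c) }
  have hrA : ∀ {a b}, |a.1| ≠ |b.1| → r a b → A a b := by
    rintro a b hab (rfl | h | ⟨rfl, -⟩)
    · exact absurd rfl hab
    · exact h
    · exact absurd (neg_abs b) hab
  have hrZ : ∀ {a}, r a (-a) → Z a := by
    rintro a (h | h | ⟨-, h⟩)
    · exact absurd h.symm (neg_ne_self a)
    · exact absurd (neg_abs a).symm h.1
    · simpa using Zneg h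
  have hr : IsDPartition r := by
    refine ⟨?_, fun a b ha hb => ?_, fun a ha => ?_⟩
    · rintro a b (rfl | h | ⟨rfl, h⟩)
      · exact Or.inl rfl
      · exact Or.inr (Or.inl (Aneg h))
      · exact Or.inr (Or.inr ⟨rfl, Zneg h⟩)
    · by_cases hab : |a.1| = |b.1|
      · rcases abs_eq_abs_iff.mp hab with rfl | rfl
        · exact Or.inl rfl
        · exact Or.inr (Or.inr ⟨rfl, hrZ hb⟩)
      · exact Or.inr (Or.inl (ZZ hab (hrZ ha) (hrZ hb)))
    · obtain ⟨c, h1, -⟩ := hrZ ha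
      have hca : c ≠ a := fun e => h1.1 (by rw [e])
      have hcn : c ≠ -a := fun e => h1.1 (by rw [e, neg_abs])
      have h5 : ({a, -a, c} : Set (PMSet n)).ncard = 3 :=
        Set.ncard_eq_three.mpr ⟨a, -a, c, (neg_ne_self a).symm, hca.symm, hcn.symm, rfl⟩
      have h6 : ({a, -a, c} : Set (PMSet n)) ⊆ {y | r a y} := by
        rintro z (rfl | rfl | rfl)
        · exact r.refl _
        · exact ha
        · exact Or.inr (Or.inl h1)
      have h7 := Set.ncard_le_ncard h6 (Set.toFinite _)
      omega
  exact ⟨⟨r, hr⟩, fun a b hab => ⟨fun h => (hrA hab h).2, fun h => Or.inr (Or.inl ⟨hab, h⟩)⟩⟩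

end IsTieFamily

/-! ### Commuting products of ties -/

/-- The submonoid generated by the ties of the pairs in a relation. -/
def tieSubmonoid (E : PMSet n → PMSet n → TM n) (r : PMSet n → PMSet n → Prop) :
    Submonoid (TM n) :=
  Submonoid.closure {x | ∃ a b : PMSet n, |a.1| ≠ |b.1| ∧ r a b ∧ x = E a b}

theorem tie_mem_tieSubmonoid (E : PMSet n → PMSet n → TM n) {a b : PMSet n} (h : |a.1| ≠ |b.1|) :
    E a b ∈ tieSubmonoid E ⊤ :=
  Submonoid.subset_closure ⟨a, b, h, trivial, rfl⟩

theorem tieSubmonoid_mono (E : PMSet n → PMSet n → TM n) {r s : PMSet n → PMSet n → Prop}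
    (h : ∀ a b, r a b → s a b) : tieSubmonoid E r ≤ tieSubmonoid E s :=
  Submonoid.closure_mono fun _ ⟨a, b, h1, h2, h3⟩ => ⟨a, b, h1, h a b h2, h3⟩

namespace IsTieFamily

variable {E : PMSet n → PMSet n → TM n} (hE : IsTieFamily E)
include hE

theorem commute_of_mem {x y : TM n} (hx : x ∈ tieSubmonoid E ⊤) (hy : y ∈ tieSubmonoid E ⊤) :
    Commute x y := by
  refine Submonoid.closure_induction₂ (motive := fun x y _ _ => Commute x y) ?_ ?_ ?_ ?_ ?_ hx hy
  · rintro x y ⟨a, b, hab, -, rfl⟩ ⟨c, d, hcd, -, rfl⟩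
    exact hE.comm hab hcd
  · exact fun x _ => Commute.one_left x
  · exact fun x _ => Commute.one_right x
  · exact fun x y z _ _ _ h1 h2 => Commute.mul_left h1 h2
  · exact fun x y z _ _ _ h1 h2 => Commute.mul_right h1 h2

theorem conj_mem (w : BraidD n) {x : TM n} (hx : x ∈ tieSubmonoid E ⊤) :
    conjBraid n w • x ∈ tieSubmonoid E ⊤ := by
  refine Submonoid.closure_induction (motive := fun x _ => conjBraid n w • x ∈ tieSubmonoid E ⊤)
    ?_ ?_ ?_ hx
  · rintro x ⟨a, b, hab, -, rfl⟩
    rw [hE.conj w a b hab]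
    exact tie_mem_tieSubmonoid E (abs_perm_ne (piD n w).2.1 hab)
  · rw [smul_one]
    exact one_mem _
  · intro x y _ _ h1 h2
    rw [smul_mul']
    exact mul_mem h1 h2

/-- The product over the finite set of pairs, taken in any order, absorbs each factor by commutation
and idempotence. The last clause pins the product down without reference to an order. -/
theorem exists_prod (r : PMSet n → PMSet n → Prop) : ∃ x ∈ tieSubmonoid E r,
    (∀ a b : PMSet n, |a.1| ≠ |b.1| → r a b → E a b * x = x) ∧
    ∀ y : TM n, (∀ a b : PMSet n, |a.1| ≠ |b.1| → r a b → E a b * y = y) → x * y = y := by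
  have key : ∀ S : Set (PMSet n × PMSet n), S.Finite →
      (∀ p ∈ S, |p.1.1| ≠ |p.2.1| ∧ r p.1 p.2) → ∃ x ∈ tieSubmonoid E r,
      (∀ p ∈ S, E p.1 p.2 * x = x) ∧
      ∀ y : TM n, (∀ p ∈ S, E p.1 p.2 * y = y) → x * y = y := by
    intro S hS
    induction S, hS using Set.Finite.induction_on with
    | empty => exact fun _ => ⟨1, one_mem _, fun p hp => absurd hp (Set.notMem_empty p),
        fun y _ => one_mul y⟩
    | @insert p S hp hS ih =>
      intro h
      obtain ⟨x, hx, h1, h2⟩ := ih fun q hq => h q (Set.mem_insert_of_mem _ hq)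
      have hp' := h p (Set.mem_insert _ _)
      refine ⟨E p.1 p.2 * x, mul_mem (Submonoid.subset_closure ⟨_, _, hp'.1, hp'.2, rfl⟩) hx,
        ?_, fun y hy => ?_⟩
      · rintro q (rfl | hq)
        · rw [← mul_assoc, hE.mul_self hp'.1]
        · rw [← mul_assoc, (hE.comm (h q (Set.mem_insert_of_mem _ hq)).1 hp'.1).eq, mul_assoc,
            h1 q hq]
      · rw [mul_assoc, h2 y fun q hq => hy q (Set.mem_insert_of_mem _ hq),
          hy p (Set.mem_insert _ _)]
  obtain ⟨x, hx, h1, h2⟩ := key {p | |p.1.1| ≠ |p.2.1| ∧ r p.1 p.2} (Set.toFinite _) fun p hp => hp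
  exact ⟨x, hx, fun a b hab hr => h1 (a, b) ⟨hab, hr⟩,
    fun y hy => h2 y fun p hp => hy p.1 p.2 hp.1 hp.2⟩

end IsTieFamily

/-! ### The homomorphism from partitions to products of ties -/

/-- `φ I` is the product of the ties of the pairs of the partition `I`. -/
structure IsTieProd (E : PMSet n → PMSet n → TM n) (φ : PD n → TM n) : Prop where
  mem : ∀ I : PD n, φ I ∈ tieSubmonoid E I.1
  absorb : ∀ (I : PD n) (a b : PMSet n), |a.1| ≠ |b.1| → I.1 a b → E a b * φ I = φ I
  mul_eq : ∀ (I : PD n) (y : TM n),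
    (∀ a b : PMSet n, |a.1| ≠ |b.1| → I.1 a b → E a b * y = y) → φ I * y = y

theorem IsTieFamily.exists_isTieProd {E : PMSet n → PMSet n → TM n} (hE : IsTieFamily E) :
    ∃ φ : PD n → TM n, IsTieProd E φ := by
  choose φ h1 h2 h3 using fun I : PD n => hE.exists_prod I.1
  exact ⟨φ, h1, h2, h3⟩

namespace IsTieProd

variable {E : PMSet n → PMSet n → TM n} {φ : PD n → TM n} (hφ : IsTieProd E φ)
  (hE : IsTieFamily E)
include hφ

theorem mem_top (I : PD n) : φ I ∈ tieSubmonoid E ⊤ :=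
  tieSubmonoid_mono E (fun _ _ _ => trivial) (hφ.mem I)

theorem map_one : φ 1 = 1 := by
  have h := hφ.mul_eq 1 1 fun a b hab h => absurd (congrArg (fun x : PMSet n => |x.1|) h) hab
  rwa [mul_one] at h

include hE

/-- Commuting elements that absorb each other are equal: y = φ(I) y = y φ(I) = φ(I). -/
theorem eq_of_absorb (I : PD n) {y : TM n} (hy : y ∈ tieSubmonoid E ⊤)
    (h1 : ∀ a b : PMSet n, |a.1| ≠ |b.1| → I.1 a b → E a b * y = y) (h2 : y * φ I = φ I) :
    φ I = y := by
  rw [← h2, ← (hE.commute_of_mem (hφ.mem_top I) hy).eq, hφ.mul_eq I y h1]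

theorem map_mul (I J : PD n) : φ (I * J) = φ I * φ J := by
  have hI := hφ.mem_top I
  have hJ := hφ.mem_top J
  refine hφ.eq_of_absorb hE _ (mul_mem hI hJ) ?_ ?_
  -- The product may contain ties present in neither I nor J. The absorbed ties form a D_n-partition
  -- above I and J, hence above `I * J`.
  · obtain ⟨K, hK⟩ := hE.exists_absorbed (φ I * φ J)
    have hle : (I * J).1 ≤ K.1 := by
      rw [PD.mul_le_iff]
      constructor
      · refine I.2.le_of_forall fun a b hab h => (hK a b hab).mpr ?_
        rw [← mul_assoc, hφ.absorb I a b hab h]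
      · refine J.2.le_of_forall fun a b hab h => (hK a b hab).mpr ?_
        rw [← mul_assoc, (hE.commute_of_mem (tie_mem_tieSubmonoid E hab) hI).eq, mul_assoc,
          hφ.absorb J a b hab h]
    exact fun a b hab h => (hK a b hab).mp (hle h)
  · have hle := PD.mul_le_iff.mp (le_refl (I * J).1)
    rw [mul_assoc, hφ.mul_eq J _ fun a b hab h => hφ.absorb _ a b hab (hle.2 h),
      hφ.mul_eq I _ fun a b hab h => hφ.absorb _ a b hab (hle.1 h)]

theorem map_rhoD (w : BraidD n) (I : PD n) : φ (rhoD n w I) = conjBraid n w • φ I := by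
  refine hφ.eq_of_absorb hE _ (hE.conj_mem w (hφ.mem_top I)) ?_ ?_
  · intro a b hab h
    have hp := (piD n w).2.1
    have e : ∀ x, (piD n w).1 ((piD n w).1⁻¹ x) = x := (piD n w).1.apply_symm_apply
    have hab' := abs_perm_ne (inv_mem hp) hab
    have h1 := hφ.absorb I _ _ hab' h
    have h2 := hE.conj w _ _ hab'
    rw [e, e] at h2
    rw [← h2, ← smul_mul', h1]
  · apply smul_left_cancel (conjBraid n w)⁻¹
    rw [smul_mul', inv_smul_smul]
    refine hφ.mul_eq I _ fun a b hab h => ?_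
    have hab' := abs_perm_ne (piD n w).2.1 hab
    rw [← inv_smul_smul (conjBraid n w) (E a b), ← smul_mul', hE.conj w a b hab,
      hφ.absorb _ _ _ hab']
    change I.1 ((piD n w).1⁻¹ ((piD n w).1 a)) ((piD n w).1⁻¹ ((piD n w).1 b))
    simpa using h

theorem map_epsIdx (k : Idx n) : φ (epsIdx k) = tmTheta k := by
  have hk : |k.lo.1| ≠ |k.hi.1| := by
    simp only [Idx.lo, Idx.hi]
    rw [abs_of_nonneg (a := |k.1| + 1) (by positivity)]
    omega
  have hE' := hE.idx k
  refine hφ.eq_of_absorb hE _ (hE' ▸ tie_mem_tieSubmonoid E hk) ?_ ?_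
  · rintro a b hab (rfl | ⟨rfl | rfl, rfl | rfl⟩ | ⟨rfl | rfl, rfl | rfl⟩)
    any_goals exact absurd rfl hab
    all_goals
      rw [← hE']
      first | rw [hE.neg] | skip
      first | rw [hE.swap _ _ hk] | skip
      exact hE.mul_self hk
  · rw [← hE']
    exact hφ.absorb _ _ _ hk ((eps_le_iff k.lo_ne).mp le_rfl)

end IsTieProd

/-! ### The isomorphism -/

/-- The homomorphism from the presented monoid to the tied monoid. -/
def tmToTied (n : ℕ) : TM n →* TiedMonoid n := PresentedMonoid.lift genVal fun _ _ h => genVal_rel h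

theorem tmToTied_of (g : Gen n) : tmToTied n (PresentedMonoid.of _ g) = genVal g := rfl

theorem tmToTied_braidUnit (w : BraidD n) : tmToTied n (braidUnit n w).1 = ⟨1, w⟩ := by
  let H : Subgroup (BraidD n) :=
    { carrier := {w | tmToTied n (braidUnit n w).1 = ⟨1, w⟩}
      one_mem' := by
        change tmToTied n (braidUnit n 1).1 = ⟨1, 1⟩
        rw [map_one, Units.val_one, map_one]
        rfl
      mul_mem' := by
        intro v w (hv : _ = _) (hw : _ = _)
        change tmToTied n (braidUnit n (v * w)).1 = ⟨1, v * w⟩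
        rw [map_mul, Units.val_mul, map_mul, hv, hw, SemiProd.mul_mk, map_one, mul_one]
      inv_mem' := by
        intro w (hw : _ = _)
        change tmToTied n (braidUnit n w⁻¹).1 = ⟨1, w⁻¹⟩
        have h1 : (⟨1, w⟩ : TiedMonoid n) * ⟨1, w⁻¹⟩ = 1 := by
          rw [SemiProd.mul_mk, map_one, mul_one, mul_inv_cancel]
          rfl
        have h2 : tmToTied n (braidUnit n w⁻¹).1 * ⟨1, w⟩ = 1 := by
          rw [← hw, ← map_mul, ← Units.val_mul, ← map_mul, inv_mul_cancel, map_one, Units.val_one,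
            map_one]
        exact left_inv_eq_right_inv h2 h1 }
  refine PresentedGroup.generated_by _ H (fun k => ?_) w
  change tmToTied n (braidUnit n (sigma k)).1 = ⟨1, sigma k⟩
  rw [braidUnit_sigma]
  rfl

theorem SemiProd.mk_conj (w : BraidD n) (I : PD n) :
    (⟨1, w⟩ : TiedMonoid n) * ⟨I, 1⟩ * ⟨1, w⁻¹⟩ = ⟨rhoD n w I, 1⟩ := by
  rw [SemiProd.mul_mk, SemiProd.mul_mk, map_one, one_mul, mul_one, mul_one, mul_inv_cancel]

/-- A tie is a conjugate of some θ_k by a braid, and conjugation in the semidirect product acts on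
partitions by `ρ`. -/
theorem IsTieFamily.tmToTied_eq {E : PMSet n → PMSet n → TM n} (hE : IsTieFamily E)
    {a b : PMSet n} (h : |a.1| ≠ |b.1|) :
    tmToTied n (E a b) = ⟨eps a b (ne_neg_of_abs_ne h), 1⟩ := by
  obtain ⟨w, k, ha, hb, hk⟩ := hE.exists_eq_theta h
  have e : E a b = conjBraid n w⁻¹ • tmTheta k := by rw [← hk, map_inv, inv_smul_smul]
  have e' : ∀ x, (piD n w⁻¹).1 ((piD n w).1 x) = x := fun x => by
    rw [map_inv]
    exact (piD n w).1.symm_apply_apply x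
  rw [e, conjBraid_smul, ← map_inv (braidUnit n), map_mul, map_mul, tmToTied_braidUnit,
    tmToTied_braidUnit]
  change _ * (⟨epsIdx k, 1⟩ : TiedMonoid n) * _ = _
  rw [SemiProd.mk_conj, epsIdx, rhoD_eps]
  simp only [← ha, ← hb, e']

/-- The image is a product of ε's lying below I, and it absorbs every ε_{a,b} with a, b tied in I;
the pairs a ≠ ±b determine I. -/
theorem IsTieProd.tmToTied_eq {E : PMSet n → PMSet n → TM n} {φ : PD n → TM n}
    (hφ : IsTieProd E φ) (hE : IsTieFamily E) (I : PD n) : tmToTied n (φ I) = ⟨I, 1⟩ := by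
  obtain ⟨J, hJ, hJI⟩ : ∃ J : PD n, tmToTied n (φ I) = ⟨J, 1⟩ ∧ J.1 ≤ I.1 := by
    refine Submonoid.closure_induction
      (motive := fun x _ => ∃ J : PD n, tmToTied n x = ⟨J, 1⟩ ∧ J.1 ≤ I.1) ?_ ?_ ?_ (hφ.mem I)
    · rintro x ⟨a, b, hab, hI, rfl⟩
      exact ⟨_, hE.tmToTied_eq hab, (eps_le_iff _).mpr hI⟩
    · exact ⟨1, by rw [_root_.map_one]; rfl, bot_le⟩
    · rintro x y - - ⟨J, hJ, hJI⟩ ⟨K, hK, hKI⟩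
      refine ⟨J * K, ?_, PD.mul_le_iff.mpr ⟨hJI, hKI⟩⟩
      rw [_root_.map_mul, hJ, hK, SemiProd.mul_mk, _root_.map_one, one_mul]
      rfl
  rw [hJ, PD.ext (le_antisymm hJI (I.2.le_of_forall fun a b hab h => ?_))]
  have h1 := congrArg (tmToTied n) (hφ.absorb I a b hab h)
  rw [_root_.map_mul, hE.tmToTied_eq hab, hJ, SemiProd.mul_mk, _root_.map_one] at h1
  have h2 : eps a b (ne_neg_of_abs_ne hab) * J = J := congrArg SemiProd.left h1
  have h3 := PD.mul_le_iff.mp (le_of_eq (congrArg Subtype.val h2))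
  exact (eps_le_iff _).mp h3.1

/-- The homomorphism from the tied monoid to the presented monoid. -/
def IsTieProd.ofTied {E : PMSet n → PMSet n → TM n} {φ : PD n → TM n}
    (hφ : IsTieProd E φ) (hE : IsTieFamily E) : TiedMonoid n →* TM n where
  toFun x := φ x.left * (braidUnit n x.right).1
  map_one' := by
    change φ 1 * (braidUnit n 1).1 = 1
    rw [hφ.map_one, _root_.map_one, Units.val_one, one_mul]
  map_mul' x y := by
    change φ (x.left * rhoD n x.right y.left) * (braidUnit n (x.right * y.right)).1 = _
    -- By equivariance φ(ρ_w J) is w φ(J) w⁻¹, and w⁻¹ cancels against the braid on its right.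
    rw [hφ.map_mul hE, hφ.map_rhoD hE, conjBraid_smul, _root_.map_mul, Units.val_mul]
    simp only [mul_assoc, Units.inv_mul_cancel_left]

/-- The presented monoid is isomorphic to the tied monoid. -/
theorem exists_mulEquiv (n : ℕ) :
    ∃ e : TM n ≃* TiedMonoid n, ∀ g : Gen n, e (PresentedMonoid.of (TiedRel n) g) = genVal g := by
  obtain ⟨E, hE⟩ := exists_isTieFamily n
  obtain ⟨φ, hφ⟩ := hE.exists_isTieProd
  refine ⟨MonoidHom.toMulEquiv (tmToTied n) (hφ.ofTied hE) ?_ ?_, tmToTied_of⟩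
  · refine PresentedMonoid.ext _ fun g => ?_
    cases g with
    | s k =>
      change φ 1 * (braidUnit n (sigma k)).1 = tmSigma k
      rw [hφ.map_one, one_mul, braidUnit_sigma]
      rfl
    | sInv k =>
      change φ 1 * (braidUnit n (sigma k)⁻¹).1 = tmSigmaInv k
      rw [hφ.map_one, one_mul, map_inv, braidUnit_sigma]
      rfl
    | th k =>
      change φ (epsIdx k) * (braidUnit n 1).1 = tmTheta k
      rw [hφ.map_epsIdx hE, map_one, Units.val_one, mul_one]
  · ext1 x
    change tmToTied n (φ x.left * (braidUnit n x.right).1) = x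
    rw [map_mul, hφ.tmToTied_eq hE, tmToTied_braidUnit, SemiProd.mul_mk, map_one, mul_one, one_mul]

end TiedD

theorem theorem5p2 (n : ℕ) (hn : 2 ≤ n) :
    ∃ e : PresentedMonoid (TiedD.TiedRel n) ≃* TiedD.TiedMonoid n,
      ∀ g : TiedD.Gen n, e (PresentedMonoid.of (TiedD.TiedRel n) g) = TiedD.genVal g :=
  TiedD.exists_mulEquiv n
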